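/- Use $\widehat f(w)=\int_{\mathbb R} f(x)e^{-2\pi i wx}\,dx$. Call $\phi\in L^1(\mathbb R)$ (complex-valued) *of type-I* if there are real numbers $v_1,v_2,\dots$ with $\sum_j v_j^2<\infty$ and a sign $\varepsilon\in\{1,-1\}$ such that for every $w\in\mathbb R$ $$\widehat\phi(w)=e^{-\pi w^2}\prod_{j=1}^{\infty}(1+2\pi i v_jw)^{-1}e^{2\pi i\varepsilon v_jw},$$ the product being the limit of its partial products (for $\varepsilon=1$ it always converges; for $\varepsilon=-1$ its convergence is part of the condition; finitely many factors are allowed by taking $v_j=0$ for large $j$). For $\gamma>0$ let $\phi_\gamma(x)=\sqrt\gamma\,\phi(\gamma x)$, and for $h>0$ let $$M_{\phi,h}=\operatorname*{ess\,sup}_{w\in[0,1/h]}\frac{\sum_{l\in\mathbb Z}(w+\frac lh)^2|\widehat\phi(w+\frac lh)|^2}{\sum_{l\in\mathbb Z}|\widehat\phi(w+\frac lh)|^2}\in[0,\infty].$$ For $\alpha,\beta>0$ the Gabor system $\mathcal G(\phi,\alpha,\beta)=\{e^{2\pi i\beta m x}\phi(x-\alpha k):k,m\in\mathbb Z\}$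 is a frame for $L^2(\mathbb R)$ if $\phi\in L^2(\mathbb R)$ and there are $A,B>0$ with $A\|f\|^2\le\sum_{k,m\in\mathbb Z}|\langle f,e^{2\pi i\beta m\cdot}\phi(\cdot-\alpha k)\rangle|^2\le B\|f\|^2$ for all $f\in L^2(\mathbb R)$. **Theorem.** If $\phi$ is of type-I, then for every $\beta>0$ $$\lim_{\gamma\to0^+}M_{\phi_\gamma,1/\beta}=\frac{\beta^2}{4}.$$ Consequently, for all $\alpha,\beta>0$ with $\alpha\beta<1$ there is a $\gamma>0$ such that $\mathcal G(\phi_\gamma,\alpha,\beta)$ is a frame for $L^2(\mathbb R)$. More precisely, $\gamma/\beta$ can be chosen to depend only on $\alpha\beta$: there is a function $\rho:(0,1)\to(0,\infty)$ such that for every $\phi$ of type-I and all $\alpha,\beta>0$ with $\alpha\beta<1$ the choice $\gamma=\rho(\alpha\beta)\,\beta$ works. -/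

import Mathlib

open MeasureTheory Filter Topology
open scoped FourierTransform ENNReal

/-- The window `φ ∈ L¹(ℝ)` is of type-I: there are real numbers `v j` with `∑ (v j)² < ∞` such that,
for every real `w`,
`φ̂(w) = exp(-π w²) * ∏_j (1 + 2π i (v j) w)⁻¹ * exp(ε * 2π i (v j) w)`,
where the infinite product is the limit of its partial products and `ε` is a fixed sign.
For `ε = 1` (Schoenberg's normalisation) the product converges for every square-summable `v`; for
`ε = -1` its convergence is part of the condition. Finite products arise when `v j = 0` for large
`j`. The Fourier transform is `φ̂(w) = ∫ φ(x) exp(-2π i w x) dx`. -/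
def IsTypeI (φ : ℝ → ℂ) : Prop :=
  Integrable φ volume ∧
  ∃ (ε : ℝ) (v : ℕ → ℝ), (ε = 1 ∨ ε = -1) ∧ (Summable fun j => v j ^ 2) ∧
    ∀ w : ℝ, Tendsto
      (fun n : ℕ => Complex.exp (-Real.pi * (w : ℂ) ^ 2) *
        ∏ j ∈ Finset.range n,
          ((1 + 2 * Real.pi * Complex.I * v j * w)⁻¹ *
            Complex.exp (ε * (2 * Real.pi * Complex.I * v j * w))))
      atTop (𝓝 (𝓕 φ w))

/-- The dilate `φ_γ(x) = √γ φ(γ x)`. -/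
noncomputable def dilate (φ : ℝ → ℂ) (γ : ℝ) : ℝ → ℂ :=
  fun x => (Real.sqrt γ : ℂ) * φ (γ * x)

/-- `B_{φ,h}(w) = (∑_l (w + l/h)² |φ̂(w + l/h)|²) / (∑_l |φ̂(w + l/h)|²)`, with values in `[0, ∞]`. -/
noncomputable def ratioB (φ : ℝ → ℂ) (h w : ℝ) : ℝ≥0∞ :=
  (∑' l : ℤ, ENNReal.ofReal ((w + l / h) ^ 2 * ‖𝓕 φ (w + l / h)‖ ^ 2)) /
    ∑' l : ℤ, ENNReal.ofReal (‖𝓕 φ (w + l / h)‖ ^ 2)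

/-- `M_{φ,h}`, the essential supremum of `B_{φ,h}` over `[0, 1/h]`, with values in `[0, ∞]`. -/
noncomputable def constM (φ : ℝ → ℂ) (h : ℝ) : ℝ≥0∞ :=
  essSup (ratioB φ h) (volume.restrict (Set.Icc 0 (1 / h)))

/-- A family `e` in a Hilbert space is a frame: `A ‖f‖² ≤ ∑_i |⟨f, e i⟩|² ≤ B ‖f‖²` for all `f`,
with constants `A, B > 0`. -/
def IsHilbertFrame {ι H : Type*} [NormedAddCommGroup H] [InnerProductSpace ℂ H]
    (e : ι → H) : Prop :=
  ∃ A B : ℝ, 0 < A ∧ 0 < B ∧ ∀ f : H,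
    (Summable fun i => ‖inner ℂ (e i) f‖ ^ 2) ∧
    A * ‖f‖ ^ 2 ≤ ∑' i, ‖inner ℂ (e i) f‖ ^ 2 ∧
    ∑' i, ‖inner ℂ (e i) f‖ ^ 2 ≤ B * ‖f‖ ^ 2

/-- The time-frequency shift `x ↦ exp(2π i β m x) φ(x - α k)`, indexed by `p = (k, m)`. -/
noncomputable def gaborAtom (φ : ℝ → ℂ) (α β : ℝ) (p : ℤ × ℤ) : ℝ → ℂ :=
  fun x => Complex.exp (2 * Real.pi * Complex.I * β * p.2 * x) * φ (x - α * p.1)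

/-- The Gabor system `𝒢(φ, α, β)` consists of square-integrable functions and is a frame for
`L²(ℝ)`. -/
def IsGaborFrame (φ : ℝ → ℂ) (α β : ℝ) : Prop :=
  ∃ hφ : ∀ p : ℤ × ℤ, MemLp (gaborAtom φ α β p) 2 (volume : Measure ℝ),
    IsHilbertFrame fun p : ℤ × ℤ => (hφ p).toLp (gaborAtom φ α β p)

/-! In `|φ̂(w)|² = exp(-2πw²) ∏ (1 + 4π²v_j²w²)⁻¹` the phases and the sign `ε` have disappeared, and
every factor is even and nonincreasing in `|w|`. Hence `|φ̂(x)|² ≤ exp(-2π(x² - u²)) |φ̂(u)|²`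
whenever `|u| ≤ |x|` (`IsTypeI.norm_sq_le`). With positivity this is all that is used of `φ̂`, and
it is independent of the `v_j`, so one `ρ` serves all windows. Dilation by `γ` multiplies the rate
by `γ⁻²`.

In a coset `w + βℤ` the point `u` nearest to `0` has `|u| ≤ β/2`, and the other points contribute
only a Gaussian tail relative to it (`GaussianDecay.tsum_sq_mul_le`). So `M ≤ β²/4 + O(γ²)`, while
cosets near `β/2 + βℤ` force `M ≥ β²/4`.

For the frame property, rescale to `β = 1`. Parseval in the modulation index turns the frame sum
into samples on `x - αℤ` of finite combinations `F` of integer translates of the window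
(`frame_bounds_of_sampling`). Since `F̂` is a 1-periodic function times the transform of the window,
`‖F'‖² ≤ 4π² M ‖F‖²`. Wirtinger's inequality on intervals of length `α` centred at the sample points
makes sampling stable if `4α²M < 1` (`exists_sampling_bounds`). As `M` approaches `1/4`, this
condition becomes `α < 1`. -/

/-! ### Gaussian decay of the transform of a type-I window. -/

/-- Uniform bounds from below for the partial products of `∏ (1 + a j)⁻¹`. -/
lemma exp_neg_tsum_le_prod_inv {a : ℕ → ℝ} (ha : ∀ j, 0 ≤ a j) (hs : Summable a) (n : ℕ) :
    Real.exp (-∑' j, a j) ≤ ∏ j ∈ Finset.range n, (1 + a j)⁻¹ := by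
  calc Real.exp (-∑' j, a j) ≤ Real.exp (∑ j ∈ Finset.range n, -a j) := by
        rw [Finset.sum_neg_distrib]
        gcongr
        exact hs.sum_le_tsum _ fun j _ => ha j
    _ = ∏ j ∈ Finset.range n, Real.exp (-a j) := Real.exp_sum _ _
    _ ≤ _ := by
        refine Finset.prod_le_prod (fun j _ => (Real.exp_pos _).le) fun j _ => ?_
        rw [Real.exp_neg]
        have := ha j
        gcongr
        linarith [Real.add_one_le_exp (a j)]

lemma norm_sq_typeI_factor (ε : ℝ) (v w : ℝ) :
    ‖(1 + 2 * Real.pi * Complex.I * v * w)⁻¹ *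
      Complex.exp (ε * (2 * Real.pi * Complex.I * v * w))‖ ^ 2 =
      (1 + 4 * Real.pi ^ 2 * w ^ 2 * v ^ 2)⁻¹ := by
  have h1 : (ε * (2 * Real.pi * Complex.I * v * w) : ℂ) =
      ((ε * (2 * Real.pi * v * w) : ℝ) : ℂ) * Complex.I := by push_cast; ring
  have h2 : (1 + 2 * Real.pi * Complex.I * v * w : ℂ) =
      ((1 : ℝ) : ℂ) + ((2 * Real.pi * v * w : ℝ) : ℂ) * Complex.I := by push_cast; ring
  rw [norm_mul, h1, Complex.norm_exp_ofReal_mul_I, mul_one, norm_inv, inv_pow, h2,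
    ← Complex.normSq_eq_norm_sq, Complex.normSq_add_mul_I]
  congr 1
  ring

lemma IsTypeI.tendsto_norm_sq {φ : ℝ → ℂ} (h : IsTypeI φ) :
    ∃ v : ℕ → ℝ, (Summable fun j => v j ^ 2) ∧ ∀ w : ℝ, Tendsto
      (fun n : ℕ => Real.exp (-2 * Real.pi * w ^ 2) *
        ∏ j ∈ Finset.range n, (1 + 4 * Real.pi ^ 2 * w ^ 2 * v j ^ 2)⁻¹)
      atTop (𝓝 (‖𝓕 φ w‖ ^ 2)) := by
  obtain ⟨-, ε, v, -, hv, H⟩ := h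
  refine ⟨v, hv, fun w => ?_⟩
  refine ((H w).norm.pow 2).congr fun n => ?_
  rw [norm_mul, mul_pow, norm_prod, ← Finset.prod_pow]
  congr 1
  · rw [show (-Real.pi * (w : ℂ) ^ 2) = ((-Real.pi * w ^ 2 : ℝ) : ℂ) by push_cast; ring,
      Complex.norm_exp_ofReal, ← Real.exp_nat_mul]
    congr 1
    push_cast
    ring
  · exact Finset.prod_congr rfl fun j _ => norm_sq_typeI_factor ε (v j) w

/-- The limit of positive partial products might vanish; summability of `v j ^ 2` keeps them above
`exp (-∑' j, 4π²w²v_j²)`. -/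
lemma IsTypeI.norm_sq_pos {φ : ℝ → ℂ} (h : IsTypeI φ) (w : ℝ) : 0 < ‖𝓕 φ w‖ ^ 2 := by
  obtain ⟨v, hv, H⟩ := h.tendsto_norm_sq
  have hs : Summable fun j => 4 * Real.pi ^ 2 * w ^ 2 * v j ^ 2 := hv.mul_left _
  refine lt_of_lt_of_le (b := Real.exp (-2 * Real.pi * w ^ 2) *
    Real.exp (-∑' j, 4 * Real.pi ^ 2 * w ^ 2 * v j ^ 2)) (by positivity) ?_
  refine ge_of_tendsto' (H w) fun n => ?_
  gcongr
  exact exp_neg_tsum_le_prod_inv (fun j => by positivity) hs n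

lemma IsTypeI.norm_sq_le {φ : ℝ → ℂ} (h : IsTypeI φ) {u x : ℝ} (hux : |u| ≤ |x|) :
    ‖𝓕 φ x‖ ^ 2 ≤ Real.exp (-(2 * Real.pi) * (x ^ 2 - u ^ 2)) * ‖𝓕 φ u‖ ^ 2 := by
  obtain ⟨v, hv, H⟩ := h.tendsto_norm_sq
  refine le_of_tendsto_of_tendsto' (H x) ((H u).const_mul _) fun n => ?_
  rw [← mul_assoc, ← Real.exp_add]
  have h2 : u ^ 2 ≤ x ^ 2 := sq_le_sq.2 hux
  refine mul_le_mul (le_of_eq ?_) ?_ (Finset.prod_nonneg fun j _ => by positivity)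
    (Real.exp_pos _).le
  · congr 1
    ring
  · refine Finset.prod_le_prod (fun j _ => by positivity) fun j _ => ?_
    gcongr

/-- `G` is positive and decays relative to any point `u` at least as fast as `exp (-a x²)`. -/
structure GaussianDecay (a : ℝ) (G : ℝ → ℝ) : Prop where
  pos : ∀ x, 0 < G x
  le : ∀ u x, |u| ≤ |x| → G x ≤ Real.exp (-a * (x ^ 2 - u ^ 2)) * G u

lemma fourier_dilate (φ : ℝ → ℂ) {γ : ℝ} (hγ : 0 < γ) (w : ℝ) :
    𝓕 (dilate φ γ) w = ((Real.sqrt γ * γ⁻¹ : ℝ) : ℂ) * 𝓕 φ (w / γ) := by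
  rw [Real.fourier_real_eq_integral_exp_smul, Real.fourier_real_eq_integral_exp_smul]
  have := Measure.integral_comp_mul_left
    (fun y : ℝ => Complex.exp (↑(-2 * Real.pi * y * (w / γ)) * Complex.I) • φ y) γ
  rw [abs_of_pos (inv_pos.2 hγ)] at this
  rw [Complex.ofReal_mul, mul_assoc, ← Complex.real_smul (x := γ⁻¹), ← this,
    ← integral_const_mul]
  congr 1 with x
  rw [show -2 * Real.pi * (γ * x) * (w / γ) = -2 * Real.pi * x * w by field_simp]
  simp only [dilate, smul_eq_mul]
  ring

lemma IsTypeI.gaussianDecay_dilate {φ : ℝ → ℂ} (h : IsTypeI φ) {γ : ℝ} (hγ : 0 < γ) :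
    GaussianDecay (2 * Real.pi / γ ^ 2) fun w => ‖𝓕 (dilate φ γ) w‖ ^ 2 := by
  have e : ∀ w, ‖𝓕 (dilate φ γ) w‖ ^ 2 = γ⁻¹ * ‖𝓕 φ (w / γ)‖ ^ 2 := fun w => by
    rw [fourier_dilate φ hγ, norm_mul, mul_pow, Complex.norm_real, Real.norm_eq_abs, sq_abs,
      mul_pow, Real.sq_sqrt hγ.le]
    field_simp
  refine ⟨fun x => ?_, fun u x hux => ?_⟩
  · rw [e]
    exact mul_pos (inv_pos.2 hγ) (h.norm_sq_pos _)
  · simp only [e]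
    have h1 : |u / γ| ≤ |x / γ| := by
      rw [abs_div, abs_div]
      gcongr
    have h2 := h.norm_sq_le h1
    have h3 : -(2 * Real.pi) * ((x / γ) ^ 2 - (u / γ) ^ 2) =
        -(2 * Real.pi / γ ^ 2) * (x ^ 2 - u ^ 2) := by
      field_simp
    rw [h3] at h2
    have := mul_le_mul_of_nonneg_left h2 (inv_pos.2 hγ).le
    linarith

/-! ### Lattice sums and the limit of `constM`. -/

/-- A constant dominating the Gaussian tails of a lattice sum. -/
noncomputable def tailConst : ℝ := ∑' l : ℤ, Real.exp (-Real.pi * (|(l : ℝ)| - 1))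

lemma summable_tail : Summable fun l : ℤ => Real.exp (-Real.pi * (|(l : ℝ)| - 1)) := by
  have h : Summable fun n : ℕ => Real.exp (-Real.pi * ((n : ℝ) - 1)) := by
    have : Summable fun n : ℕ => Real.exp Real.pi * Real.exp (-(n : ℝ)) :=
      Real.summable_exp_neg_nat.mul_left _
    refine this.of_nonneg_of_le (fun _ => (Real.exp_pos _).le) fun n => ?_
    rw [← Real.exp_add]
    have : (0 : ℝ) ≤ n := n.cast_nonneg
    gcongr
    nlinarith [Real.pi_gt_three]
  refine Summable.of_nat_of_neg ?_ ?_ <;> simpa using h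

lemma tailConst_nonneg : 0 ≤ tailConst := tsum_nonneg fun _ => (Real.exp_pos _).le

/-- Expanding the square gives the gap `|l| (|l| - 1) β²`, which is nonnegative because `l` is an
integer. The weaker linear bound suffices for summability. -/
lemma lattice_gap {β u : ℝ} (hβ : 0 < β) (hu : |u| ≤ β / 2) (l : ℤ) :
    0 ≤ (u + l * β) ^ 2 - u ^ 2 ∧
      β ^ 2 * (|(l : ℝ)| - 1) ≤ (u + l * β) ^ 2 - u ^ 2 := by
  have h1 : (u + l * β) ^ 2 - u ^ 2 = |(l : ℝ)| ^ 2 * β ^ 2 + 2 * (l * β * u) := by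
    rw [sq_abs]; ring
  have h2 : -(|(l : ℝ)| * β * (β / 2)) ≤ l * β * u := by
    have : |(l : ℝ) * β * u| ≤ |(l : ℝ)| * β * (β / 2) := by
      rw [abs_mul, abs_mul, abs_of_pos hβ]
      gcongr
    linarith [neg_abs_le ((l : ℝ) * β * u)]
  have h3 : 0 ≤ |(l : ℝ)| * (|(l : ℝ)| - 1) := by
    rcases eq_or_ne l 0 with rfl | h
    · simp
    · have : (1 : ℝ) ≤ |(l : ℝ)| := by exact_mod_cast Int.one_le_abs h
      nlinarith
  have h4 := mul_nonneg h3 (sq_nonneg β)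
  constructor
  · nlinarith
  · nlinarith [mul_nonneg (sq_nonneg (|(l : ℝ)| - 1)) (sq_nonneg β)]

/-- Half of the exponent absorbs the factor `y`, by `t exp(-t) ≤ 1`; the other half remains to be
summed over the lattice. -/
lemma mul_exp_neg_le {a y : ℝ} (ha : 0 < a) :
    y * Real.exp (-a * y) ≤ 2 / a * Real.exp (-(a * y / 2)) := by
  have h1 : a * y / 2 ≤ Real.exp (a * y / 2) := by linarith [Real.add_one_le_exp (a * y / 2)]
  have h2 : a * y / 2 * Real.exp (-(a * y / 2)) ≤ 1 := by
    rw [Real.exp_neg, ← div_eq_mul_inv, div_le_one (Real.exp_pos _)]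
    exact h1
  have h3 : Real.exp (-a * y) = Real.exp (-(a * y / 2)) * Real.exp (-(a * y / 2)) := by
    rw [← Real.exp_add]; ring_nf
  calc y * Real.exp (-a * y) = 2 / a * (a * y / 2 * Real.exp (-(a * y / 2))) *
        Real.exp (-(a * y / 2)) := by rw [h3]; field_simp
    _ ≤ 2 / a * 1 * Real.exp (-(a * y / 2)) := by gcongr
    _ = _ := by ring

/-- Every real number is a translate, by a multiple of `β`, of one of modulus at most `β / 2`. -/
lemma exists_abs_add_int_mul_le {β : ℝ} (hβ : 0 < β) (w : ℝ) :
    ∃ l : ℤ, |w + l * β| ≤ β / 2 := by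
  refine ⟨-round (w / β), ?_⟩
  have h := abs_sub_round (w / β)
  have : w + ((-round (w / β) : ℤ) : ℝ) * β = (w / β - round (w / β)) * β := by
    push_cast
    field_simp
    ring
  rw [this, abs_mul, abs_of_pos hβ]
  nlinarith

lemma tsum_int_shift (F : ℝ → ℝ≥0∞) (w β : ℝ) (k : ℤ) :
    ∑' l : ℤ, F (w + k * β + l * β) = ∑' l : ℤ, F (w + l * β) := by
  rw [← (Equiv.addLeft k).tsum_eq fun l : ℤ => F (w + l * β)]
  refine tsum_congr fun l => ?_
  simp only [Equiv.coe_addLeft]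
  push_cast
  ring_nf

/-- The key estimate: the second moment of a lattice sum with Gaussian decay. -/
lemma GaussianDecay.tsum_sq_mul_le {a β : ℝ} {G : ℝ → ℝ} (hG : GaussianDecay a G) (ha : 0 < a)
    (hβ : 0 < β) (hab : 2 * Real.pi ≤ a * β ^ 2) (w : ℝ) :
    ∑' l : ℤ, ENNReal.ofReal ((w + l * β) ^ 2 * G (w + l * β)) ≤
      ENNReal.ofReal (β ^ 2 / 4 + 2 / a * tailConst) *
        ∑' l : ℤ, ENNReal.ofReal (G (w + l * β)) := by
  obtain ⟨k, hk⟩ := exists_abs_add_int_mul_le hβ w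
  rw [← tsum_int_shift (fun x => ENNReal.ofReal (x ^ 2 * G x)) w β k,
    ← tsum_int_shift (fun x => ENNReal.ofReal (G x)) w β k]
  set u := w + k * β with hu
  have hK := tailConst_nonneg
  -- Split `x² = u² + (x² - u²)`: the first part is at most `β²/4`, the second is paid for by the
  -- decay of `G` from `u` to `x`.
  have term : ∀ l : ℤ, ENNReal.ofReal ((u + l * β) ^ 2 * G (u + l * β)) ≤
      ENNReal.ofReal (β ^ 2 / 4) * ENNReal.ofReal (G (u + l * β)) +
      ENNReal.ofReal (Real.exp (-Real.pi * (|(l : ℝ)| - 1))) *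
        ENNReal.ofReal (2 / a * G u) := by
    intro l
    obtain ⟨g1, g2⟩ := lattice_gap hβ hk l
    set x := u + l * β
    have hG0 := hG.pos x
    have hGu := hG.pos u
    rw [← ENNReal.ofReal_mul (by positivity), ← ENNReal.ofReal_mul (Real.exp_pos _).le,
      ← ENNReal.ofReal_add (by positivity) (by positivity)]
    refine ENNReal.ofReal_le_ofReal ?_
    have h1 : G x ≤ Real.exp (-a * (x ^ 2 - u ^ 2)) * G u :=
      hG.le u x (sq_le_sq.1 (by linarith))
    set y := x ^ 2 - u ^ 2
    have h2 : y * G x ≤ 2 / a * Real.exp (-(a * y / 2)) * G u :=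
      calc y * G x ≤ y * (Real.exp (-a * y) * G u) := by gcongr
        _ = y * Real.exp (-a * y) * G u := by ring
        _ ≤ _ := mul_le_mul_of_nonneg_right (mul_exp_neg_le ha) hGu.le
    have h3 : Real.exp (-(a * y / 2)) ≤ Real.exp (-Real.pi * (|(l : ℝ)| - 1)) := by
      gcongr
      rw [neg_mul, neg_le_neg_iff]
      -- If `|l| ≥ 1`, then `2π ≤ aβ²` makes half the exponent dominate `π(|l| - 1)`. If `|l| ≤ 1`,
      -- the left side is nonpositive and `y ≥ 0` is enough.
      rcases le_total 0 (|(l : ℝ)| - 1) with h | h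
      · nlinarith
      · have : 0 ≤ a * y := by positivity
        nlinarith [Real.pi_pos]
    have h4 : 2 / a * Real.exp (-(a * y / 2)) * G u ≤
        2 / a * Real.exp (-Real.pi * (|(l : ℝ)| - 1)) * G u := by gcongr
    have h5 : u ^ 2 ≤ β ^ 2 / 4 := by
      have := sq_le_sq' (by linarith [abs_nonneg u]) hk
      rw [sq_abs] at this
      linarith
    have h6 : u ^ 2 * G x ≤ β ^ 2 / 4 * G x := by gcongr
    have h7 : x ^ 2 * G x = u ^ 2 * G x + y * G x := by simp only [y]; ring
    linarith
  calc _ ≤ ∑' l : ℤ, (ENNReal.ofReal (β ^ 2 / 4) * ENNReal.ofReal (G (u + l * β)) +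
      ENNReal.ofReal (Real.exp (-Real.pi * (|(l : ℝ)| - 1))) *
        ENNReal.ofReal (2 / a * G u)) := ENNReal.tsum_le_tsum term
    _ = ENNReal.ofReal (β ^ 2 / 4) * ∑' l : ℤ, ENNReal.ofReal (G (u + l * β)) +
        ENNReal.ofReal tailConst * ENNReal.ofReal (2 / a * G u) := by
      rw [ENNReal.tsum_add, ENNReal.tsum_mul_left, ENNReal.tsum_mul_right, tailConst,
        ENNReal.ofReal_tsum_of_nonneg (fun _ => (Real.exp_pos _).le) summable_tail]
    _ ≤ ENNReal.ofReal (β ^ 2 / 4) * ∑' l : ℤ, ENNReal.ofReal (G (u + l * β)) +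
        ENNReal.ofReal (2 / a * tailConst) * ∑' l : ℤ, ENNReal.ofReal (G (u + l * β)) := by
      refine add_le_add le_rfl ?_
      calc ENNReal.ofReal tailConst * ENNReal.ofReal (2 / a * G u)
          = ENNReal.ofReal (2 / a * tailConst) * ENNReal.ofReal (G u) := by
            rw [← ENNReal.ofReal_mul hK, ← ENNReal.ofReal_mul (by positivity)]
            ring_nf
        _ ≤ _ := by
            gcongr
            simpa using ENNReal.le_tsum (f := fun l : ℤ => ENNReal.ofReal (G (u + l * β))) 0
    _ = _ := by
      rw [← add_mul, ← ENNReal.ofReal_add (by positivity) (by positivity)]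

lemma GaussianDecay.tsum_le {a β : ℝ} {G : ℝ → ℝ} (hG : GaussianDecay a G) (ha : 0 < a)
    (hβ : 0 < β) (hab : 2 * Real.pi ≤ a * β ^ 2) (w : ℝ) :
    ∑' l : ℤ, ENNReal.ofReal (G (w + l * β)) ≤ ENNReal.ofReal (tailConst * G 0) := by
  obtain ⟨k, hk⟩ := exists_abs_add_int_mul_le hβ w
  rw [← tsum_int_shift (fun x => ENNReal.ofReal (G x)) w β k]
  set u := w + k * β with hu
  have hG0 := hG.pos 0
  rw [ENNReal.ofReal_mul tailConst_nonneg, tailConst,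
    ENNReal.ofReal_tsum_of_nonneg (fun _ => (Real.exp_pos _).le) summable_tail,
    ← ENNReal.tsum_mul_right]
  refine ENNReal.tsum_le_tsum fun l => ?_
  rw [← ENNReal.ofReal_mul (Real.exp_pos _).le]
  refine ENNReal.ofReal_le_ofReal ?_
  obtain ⟨g1, g2⟩ := lattice_gap hβ hk l
  set x := u + l * β
  refine (hG.le 0 x (by simp)).trans ?_
  refine mul_le_mul_of_nonneg_right (Real.exp_le_exp.2 ?_) hG0.le
  have hx : 0 ≤ x ^ 2 := sq_nonneg x
  rw [neg_mul, neg_mul, neg_le_neg_iff]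
  rcases le_total 0 (|(l : ℝ)| - 1) with h | h
  · nlinarith [sq_nonneg u, Real.pi_pos, mul_nonneg Real.pi_pos.le h]
  · have : 0 ≤ a * x ^ 2 := by positivity
    nlinarith [Real.pi_pos]

/-- Every coset meets `[-β/2, β/2]`, where `G` is at least `G β`. Together with
`GaussianDecay.tsum_le` this bounds the periodization of `G` away from `0` and `∞`. -/
lemma GaussianDecay.le_tsum {a β : ℝ} {G : ℝ → ℝ} (hG : GaussianDecay a G) (ha : 0 < a)
    (hβ : 0 < β) (w : ℝ) :
    ENNReal.ofReal (G β) ≤ ∑' l : ℤ, ENNReal.ofReal (G (w + l * β)) := by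
  obtain ⟨k, hk⟩ := exists_abs_add_int_mul_le hβ w
  refine le_trans (ENNReal.ofReal_le_ofReal ?_) (ENNReal.le_tsum k)
  have h1 : |w + k * β| ≤ |β| := by rw [abs_of_pos hβ]; linarith
  refine (hG.le _ _ h1).trans (mul_le_of_le_one_left (hG.pos _).le ?_)
  rw [Real.exp_le_one_iff]
  nlinarith [sq_le_sq.2 h1]

lemma constM_dilate_le {φ : ℝ → ℂ} (h : IsTypeI φ) {β γ : ℝ} (hβ : 0 < β) (hγ : 0 < γ)
    (hγβ : γ ≤ β) :
    constM (dilate φ γ) (1 / β) ≤ ENNReal.ofReal (β ^ 2 / 4 + γ ^ 2 / Real.pi * tailConst) := by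
  have hG := h.gaussianDecay_dilate hγ
  have ha : 0 < 2 * Real.pi / γ ^ 2 := by positivity
  have hab : 2 * Real.pi ≤ 2 * Real.pi / γ ^ 2 * β ^ 2 := by
    rw [div_mul_eq_mul_div, le_div_iff₀ (by positivity)]
    gcongr
  refine essSup_le_of_ae_le _ (Eventually.of_forall fun w => ?_)
  simp only [ratioB, div_div_eq_mul_div, div_one]
  have key := hG.tsum_sq_mul_le ha hβ hab w
  have e : 2 / (2 * Real.pi / γ ^ 2) = γ ^ 2 / Real.pi := by field_simp
  rw [e] at key
  refine ENNReal.div_le_of_le_mul key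

/-- For `w` in `(δ, β - δ)` every lattice point `w + lβ` has modulus at least `δ`, so the ratio is
at least `δ²` on a set of positive measure. Then `δ` tends to `β/2`. -/
lemma le_constM_dilate {φ : ℝ → ℂ} (h : IsTypeI φ) {β γ : ℝ} (hβ : 0 < β) (hγ : 0 < γ)
    (hγβ : γ ≤ β) :
    ENNReal.ofReal (β ^ 2 / 4) ≤ constM (dilate φ γ) (1 / β) := by
  have hG := h.gaussianDecay_dilate hγ
  have ha : 0 < 2 * Real.pi / γ ^ 2 := by positivity
  have hab : 2 * Real.pi ≤ 2 * Real.pi / γ ^ 2 * β ^ 2 := by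
    rw [div_mul_eq_mul_div, le_div_iff₀ (by positivity)]
    gcongr
  have lower : ∀ δ, 0 ≤ δ → δ < β / 2 → ∀ w ∈ Set.Ioo δ (β - δ),
      ENNReal.ofReal (δ ^ 2) ≤ ratioB (dilate φ γ) (1 / β) w := by
    intro δ hδ hδ2 w hw
    simp only [ratioB, div_div_eq_mul_div, div_one]
    have hpos : (∑' l : ℤ, ENNReal.ofReal (‖𝓕 (dilate φ γ) (w + l * β)‖ ^ 2)) ≠ 0 := by
      have := hG.le_tsum ha hβ w
      have h0 := ENNReal.ofReal_pos.2 (hG.pos β)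
      exact (h0.trans_le this).ne'
    have hfin : (∑' l : ℤ, ENNReal.ofReal (‖𝓕 (dilate φ γ) (w + l * β)‖ ^ 2)) ≠ ⊤ :=
      ((hG.tsum_le ha hβ hab w).trans_lt ENNReal.ofReal_lt_top).ne
    rw [ENNReal.le_div_iff_mul_le (Or.inl hpos) (Or.inl hfin), ← ENNReal.tsum_mul_left]
    refine ENNReal.tsum_le_tsum fun l => ?_
    rw [← ENNReal.ofReal_mul (by positivity)]
    refine ENNReal.ofReal_le_ofReal ?_
    gcongr ?_ * _
    rw [sq_le_sq, abs_of_nonneg hδ, le_abs]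
    rcases le_or_gt 0 l with hl | hl
    · left
      have : (0 : ℝ) ≤ l := by exact_mod_cast hl
      nlinarith [hw.1]
    · right
      have : (l : ℝ) ≤ -1 := by exact_mod_cast Int.le_sub_one_of_lt hl
      nlinarith [hw.2]
  have step : ∀ δ, 0 ≤ δ → δ < β / 2 →
      ENNReal.ofReal (δ ^ 2) ≤ constM (dilate φ γ) (1 / β) := by
    intro δ hδ hδ2
    by_contra! hlt
    have hae : ∀ᵐ w ∂volume.restrict (Set.Icc 0 (1 / (1 / β))),
        ratioB (dilate φ γ) (1 / β) w ≤ constM (dilate φ γ) (1 / β) := ae_le_essSup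
    have hsub : Set.Ioo δ (β - δ) ⊆ Set.Icc 0 (1 / (1 / β)) := by
      rw [one_div_one_div]
      exact fun w hw => ⟨by linarith [hw.1], by linarith [hw.2]⟩
    have hae2 := ae_restrict_of_ae_restrict_of_subset hsub hae
    rw [ae_restrict_iff' measurableSet_Ioo] at hae2
    have hnull : volume (Set.Ioo δ (β - δ)) = 0 := by
      refine measure_mono_null (fun w hw => ?_) (ae_iff.1 hae2)
      simp only [Set.mem_ofPred_eq, Classical.not_imp, not_le]
      exact ⟨hw, hlt.trans_le (lower δ hδ hδ2 w hw)⟩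
    rw [Real.volume_Ioo, ENNReal.ofReal_eq_zero] at hnull
    linarith
  have hlim : Tendsto (fun δ : ℝ => ENNReal.ofReal (δ ^ 2)) (𝓝[<] (β / 2))
      (𝓝 (ENNReal.ofReal (β ^ 2 / 4))) := by
    rw [show β ^ 2 / 4 = (β / 2) ^ 2 by ring]
    exact (ENNReal.continuous_ofReal.comp (continuous_pow 2)).continuousWithinAt
  refine le_of_tendsto hlim ?_
  have : Set.Ioo 0 (β / 2) ∈ 𝓝[<] (β / 2) := Ioo_mem_nhdsLT (by positivity)
  filter_upwards [this] with δ hδ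
  exact step δ hδ.1.le hδ.2

/-- The limit of `M_{φ_γ, 1/β}` as `γ → 0⁺`. -/
theorem tendsto_constM_dilate {φ : ℝ → ℂ} (h : IsTypeI φ) {β : ℝ} (hβ : 0 < β) :
    Tendsto (fun γ : ℝ => constM (dilate φ γ) (1 / β)) (𝓝[>] 0)
      (𝓝 (ENNReal.ofReal (β ^ 2 / 4))) := by
  have hup : Tendsto
      (fun γ : ℝ => ENNReal.ofReal (β ^ 2 / 4 + γ ^ 2 / Real.pi * tailConst)) (𝓝[>] 0)
      (𝓝 (ENNReal.ofReal (β ^ 2 / 4))) := by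
    have hc : Continuous fun γ : ℝ =>
        ENNReal.ofReal (β ^ 2 / 4 + γ ^ 2 / Real.pi * tailConst) :=
      ENNReal.continuous_ofReal.comp (by fun_prop)
    have := (hc.tendsto 0).mono_left (nhdsWithin_le_nhds (s := Set.Ioi 0))
    simpa using this
  have hmem : Set.Ioc 0 β ∈ 𝓝[>] (0 : ℝ) := Ioc_mem_nhdsGT hβ
  refine tendsto_of_tendsto_of_tendsto_of_le_of_le' tendsto_const_nhds hup ?_ ?_
  · filter_upwards [hmem] with γ hγ
    exact le_constM_dilate h hβ hγ.1 hγ.2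
  · filter_upwards [hmem] with γ hγ
    exact constM_dilate_le h hβ hγ.1 hγ.2

/-! ### Fourier inversion, Plancherel and an `L²` bound for derivatives. -/

lemma MeasureTheory.Integrable.continuous_fourier {f : ℝ → ℂ} (hf : Integrable f) :
    Continuous (𝓕 f) :=
  VectorFourier.fourierIntegral_continuous Real.continuous_fourierChar (by fun_prop) hf

lemma integral_fourier_mul_flip {f g : ℝ → ℂ} (hf : Integrable f) (hg : Integrable g) :
    ∫ x, 𝓕 f x * g x = ∫ x, f x * 𝓕 g x := by
  have := VectorFourier.integral_fourierIntegral_smul_eq_flip (L := innerₗ ℝ) (μ := volume)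
    (ν := volume) Real.continuous_fourierChar (by fun_prop) hf hg
  rw [flip_innerₗ] at this
  exact this

lemma integral_fourierInv_mul_flip {f g : ℝ → ℂ} (hf : Integrable f) (hg : Integrable g) :
    ∫ x, 𝓕⁻ f x * g x = ∫ x, f x * 𝓕⁻ g x := by
  rw [Real.fourierInv_eq_fourier_comp_neg g, ← integral_fourier_mul_flip hf hg.comp_neg,
    ← integral_neg_eq_self]
  simp [Real.fourierInv_eq_fourier_neg]

/-- Fourier inversion for an integrable function with integrable Fourier transform, almost
everywhere and without a continuity assumption. -/
lemma ae_eq_fourierInv_fourier {f : ℝ → ℂ} (hf : Integrable f) (hF : Integrable (𝓕 f)) :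
    f =ᵐ[volume] 𝓕⁻ (𝓕 f) := by
  have hc : Continuous (𝓕⁻ (𝓕 f)) := by
    rw [Real.fourierInv_eq_fourier_comp_neg]
    exact hF.comp_neg.continuous_fourier
  refine ae_eq_of_integral_contDiff_smul_eq hf.locallyIntegrable hc.locallyIntegrable
    fun g hg hgs => ?_
  have hg1 : ContDiff ℝ (⊤ : ℕ∞) (fun x => (g x : ℂ)) := Complex.ofRealCLM.contDiff.comp hg
  have hg2 : HasCompactSupport (fun x => (g x : ℂ)) :=
    hgs.comp_left (g := fun y : ℝ => (y : ℂ)) Complex.ofReal_zero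
  -- On a Schwartz test function inversion is known and both transforms are integrable, so two
  -- applications of the multiplication formula move `𝓕⁻ 𝓕` from `f` to `b`.
  set b : SchwartzMap ℝ ℂ := hg2.toSchwartzMap hg1
  have hb : ∀ x, b x = (g x : ℂ) := fun x => rfl
  have hbi : Integrable (𝓕⁻ (b : ℝ → ℂ)) := by
    rw [← SchwartzMap.fourierInv_coe]
    exact SchwartzMap.integrable _
  have hbb : 𝓕 (𝓕⁻ (b : ℝ → ℂ)) = b := by
    rw [← SchwartzMap.fourierInv_coe, ← SchwartzMap.fourier_coe]
    simp
  have e1 := integral_fourier_mul_flip hf hbi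
  rw [hbb] at e1
  have e2 := integral_fourierInv_mul_flip hF b.integrable
  have e3 := e2.trans e1
  simp only [hb] at e3
  simp only [Complex.real_smul]
  simp only [mul_comm (g _ : ℂ)]
  exact e3.symm

lemma fourier_conj (f : ℝ → ℂ) (w : ℝ) :
    𝓕 (fun x => starRingEnd ℂ (f x)) w = starRingEnd ℂ (𝓕⁻ f w) := by
  rw [Real.fourier_eq', Real.fourierInv_eq', ← integral_conj]
  congr 1 with x
  simp only [smul_eq_mul, map_mul, ← Complex.exp_conj, Complex.conj_I, Complex.conj_ofReal]
  congr 2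
  push_cast
  ring

/-- Plancherel's identity for a continuous integrable function with integrable Fourier
transform. -/
lemma lintegral_norm_sq_fourier {f : ℝ → ℂ} (hc : Continuous f) (hf : Integrable f)
    (hF : Integrable (𝓕 f)) :
    ∫⁻ x, ENNReal.ofReal (‖f x‖ ^ 2) = ∫⁻ w, ENNReal.ofReal (‖𝓕 f w‖ ^ 2) := by
  have hinv := hc.fourierInv_fourier_eq hf hF
  have hbd : ∀ x, ‖f x‖ ≤ ∫ w, ‖𝓕 f w‖ := fun x => by
    rw [← congrFun hinv x]
    exact VectorFourier.norm_fourierIntegral_le_integral_norm _ _ _ _ _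
  have hbdF : ∀ w, ‖𝓕 f w‖ ≤ ∫ x, ‖f x‖ := fun w =>
    VectorFourier.norm_fourierIntegral_le_integral_norm _ _ _ _ _
  have sqint : ∀ {g : ℝ → ℂ} {C : ℝ}, Integrable g → (∀ x, ‖g x‖ ≤ C) →
      Integrable fun x => ‖g x‖ ^ 2 := fun {g C} hg hC => by
    simp only [sq]
    exact hg.norm.bdd_mul (c := C) hg.norm.aestronglyMeasurable
      (Eventually.of_forall fun x => by simpa using hC x)
  -- The transform of `conj (𝓕 f)` is `conj (𝓕⁻ (𝓕 f)) = conj f`, so the multiplication formula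
  -- becomes Plancherel's identity.
  have key := integral_fourier_mul_flip hf (g := fun w => starRingEnd ℂ (𝓕 f w))
    ((LinearIsometryEquiv.integrable_comp_iff Complex.conjLIE).2 hF)
  simp only [fourier_conj, hinv, Complex.mul_conj, Complex.normSq_eq_norm_sq] at key
  rw [integral_complex_ofReal, integral_complex_ofReal, Complex.ofReal_inj] at key
  rw [← ofReal_integral_eq_lintegral_ofReal (sqint hf hbd)
      (Eventually.of_forall fun x => by positivity),
    ← ofReal_integral_eq_lintegral_ofReal (sqint hF hbdF)
      (Eventually.of_forall fun x => by positivity), key]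

lemma fourier_comp_add (f : ℝ → ℂ) (s w : ℝ) :
    𝓕 (fun x => f (x + s)) w = Complex.exp (2 * Real.pi * s * w * Complex.I) * 𝓕 f w := by
  rw [Real.fourier_real_eq_integral_exp_smul, Real.fourier_real_eq_integral_exp_smul,
    ← integral_const_mul, ← integral_add_right_eq_self
      (fun x : ℝ => Complex.exp (2 * Real.pi * s * w * Complex.I) *
        Complex.exp (↑(-2 * Real.pi * x * w) * Complex.I) • f x) s]
  congr 1 with x
  rw [smul_eq_mul, smul_eq_mul, ← mul_assoc, ← Complex.exp_add]
  congr 2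
  push_cast
  ring

lemma norm_exp_sub_one_le (θ : ℝ) : ‖Complex.exp (θ * Complex.I) - 1‖ ≤ |θ| := by
  have := Real.norm_exp_I_mul_ofReal_sub_one_le (x := θ)
  rwa [mul_comm, Real.norm_eq_abs] at this

/-- Derivative of a function whose Fourier transform decays, with a bound for its `L²` norm. -/
lemma exists_deriv_of_integrable_fourier {f : ℝ → ℂ} (hc : Continuous f) (hf : Integrable f)
    (hF : Integrable (𝓕 f)) (hwF : Integrable fun w : ℝ => w • 𝓕 f w) :
    ∃ D : ℝ → ℂ, Continuous D ∧ (∀ x, HasDerivAt f (D x) x) ∧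
      ∫⁻ x, ENNReal.ofReal (‖D x‖ ^ 2) ≤
        ENNReal.ofReal (4 * Real.pi ^ 2) *
          ∫⁻ w, ENNReal.ofReal (w ^ 2 * ‖𝓕 f w‖ ^ 2) := by
  have hinv := hc.fourierInv_fourier_eq hf hF
  rw [Real.fourierInv_eq_fourier_comp_neg] at hinv
  have hw' : Integrable fun w : ℝ => w • 𝓕 f (-w) := by
    have := hwF.comp_neg.neg
    refine this.congr (Eventually.of_forall fun w => ?_)
    simp
  have hder := Real.hasDerivAt_fourier hF.comp_neg hw'
  rw [hinv] at hder
  set D := 𝓕 fun w : ℝ => (-2 * Real.pi * Complex.I * w) • 𝓕 f (-w) with hD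
  have hDc : Continuous D := by
    refine MeasureTheory.Integrable.continuous_fourier ?_
    refine (hw'.const_mul (-2 * Real.pi * Complex.I)).congr (Eventually.of_forall fun w => ?_)
    simp only [smul_eq_mul, Complex.real_smul]
    ring
  refine ⟨D, hDc, hder, ?_⟩
  -- Integrability of `D` is not available, so Plancherel is applied to difference quotients, whose
  -- transforms are bounded by `2π|w| ‖𝓕 f w‖`. Fatou's lemma then passes to the limit.
  set s : ℕ → ℝ := fun n => 1 / ((n : ℝ) + 1) with hs
  have hs0 : ∀ n, 0 < s n := fun n => by positivity
  set q : ℕ → ℝ → ℂ := fun n x => (s n)⁻¹ * (f (x + s n) - f x) with hq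
  have hqlim : ∀ x, Tendsto (fun n => q n x) atTop (𝓝 (D x)) := by
    intro x
    have h1 := (hder x).tendsto_slope_zero_right
    have h2 : Tendsto s atTop (𝓝[>] 0) := tendsto_nhdsWithin_iff.2
      ⟨tendsto_one_div_add_atTop_nhds_zero_nat, Eventually.of_forall hs0⟩
    refine (h1.comp h2).congr fun n => ?_
    simp [hq]
  have hqc : ∀ n, Continuous (q n) := fun n => by
    simp only [hq]
    fun_prop
  have hqi : ∀ n, Integrable (q n) := fun n =>
    ((hf.comp_add_right (s n)).sub hf).const_mul _
  have hqF : ∀ n w, 𝓕 (q n) w =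
      (s n)⁻¹ * (Complex.exp (2 * Real.pi * s n * w * Complex.I) - 1) * 𝓕 f w := by
    intro n w
    have e0 : 𝓕 (fun x => f (x + s n) - f x) w =
        𝓕 (fun x => f (x + s n)) w - 𝓕 f w := by
      simp only [Real.fourier_eq, smul_sub]
      exact integral_sub ((Real.fourierIntegral_convergent_iff w).2 (hf.comp_add_right (s n)))
        ((Real.fourierIntegral_convergent_iff w).2 hf)
    have e1 : 𝓕 (q n) w = (s n)⁻¹ * 𝓕 (fun x => f (x + s n) - f x) w := by
      simp only [Real.fourier_eq, hq, Circle.smul_def, smul_eq_mul]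
      rw [← integral_const_mul]
      congr 1 with x
      ring
    rw [e1, e0, fourier_comp_add]
    ring
  have hqb : ∀ n w, ‖𝓕 (q n) w‖ ≤ 2 * Real.pi * |w| * ‖𝓕 f w‖ := by
    intro n w
    rw [hqF, norm_mul, norm_mul]
    refine mul_le_mul_of_nonneg_right ?_ (norm_nonneg _)
    have := norm_exp_sub_one_le (2 * Real.pi * s n * w)
    push_cast at this
    rw [Complex.norm_real, norm_inv, Real.norm_eq_abs, abs_of_pos (hs0 n),
      inv_mul_le_iff₀ (hs0 n)]
    refine this.trans (le_of_eq ?_)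
    rw [abs_mul, abs_of_pos (by have := hs0 n; positivity)]
    ring
  have hqFi : ∀ n, Integrable (𝓕 (q n)) := fun n => by
    refine (hwF.norm.const_mul (2 * Real.pi)).mono'
      (hqi n).continuous_fourier.aestronglyMeasurable (Eventually.of_forall fun w => ?_)
    rw [norm_smul, Real.norm_eq_abs]
    linarith [hqb n w]
  have hbound : ∀ n, ∫⁻ x, ENNReal.ofReal (‖q n x‖ ^ 2) ≤
      ENNReal.ofReal (4 * Real.pi ^ 2) * ∫⁻ w, ENNReal.ofReal (w ^ 2 * ‖𝓕 f w‖ ^ 2) := by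
    intro n
    rw [lintegral_norm_sq_fourier (hqc n) (hqi n) (hqFi n),
      ← lintegral_const_mul' _ _ ENNReal.ofReal_ne_top]
    refine lintegral_mono fun w => ?_
    rw [← ENNReal.ofReal_mul (by positivity)]
    refine ENNReal.ofReal_le_ofReal ?_
    calc ‖𝓕 (q n) w‖ ^ 2 ≤ (2 * Real.pi * |w| * ‖𝓕 f w‖) ^ 2 := by gcongr; exact hqb n w
      _ = _ := by rw [mul_pow, mul_pow, sq_abs]; ring
  calc ∫⁻ x, ENNReal.ofReal (‖D x‖ ^ 2)
      = ∫⁻ x, liminf (fun n => ENNReal.ofReal (‖q n x‖ ^ 2)) atTop := by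
        refine lintegral_congr fun x => ?_
        refine (Tendsto.liminf_eq ?_).symm
        exact (ENNReal.continuous_ofReal.tendsto _).comp ((hqlim x).norm.pow 2)
    _ ≤ liminf (fun n => ∫⁻ x, ENNReal.ofReal (‖q n x‖ ^ 2)) atTop :=
        lintegral_liminf_le fun n => by
          have := (hqc n).measurable
          fun_prop
    _ ≤ _ := liminf_le_of_frequently_le' (Frequently.of_forall hbound)

/-! ### Wirtinger's inequality and sampling. -/

/-- Wirtinger's inequality on an interval, for a function vanishing at the left endpoint. -/
lemma wirtinger_of_zero_left {g g' : ℝ → ℂ} (hg : ∀ x, HasDerivAt g (g' x) x)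
    (hg' : Continuous g') (h0 : g 0 = 0) {c L : ℝ} (hc : 0 < c) (hL : 0 < L)
    (hcL : c * L < Real.pi / 2) :
    c ^ 2 * ∫ x in 0..L, ‖g x‖ ^ 2 ≤ ∫ x in 0..L, ‖g' x‖ ^ 2 := by
  have hgc : Continuous g := continuous_iff_continuousAt.2 fun x => (hg x).continuousAt
  -- The phase runs from `π/2 - cL > 0` to `π/2`, so `c cot θ` is finite on `[0, L]` and vanishes at
  -- `L`. It solves the Riccati equation `lam' = -c² - lam²`.
  set θ : ℝ → ℝ := fun x => c * x + (Real.pi / 2 - c * L) with hθ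
  have hθd : ∀ x, HasDerivAt θ c x := fun x =>
    ((hasDerivAt_id x).const_mul c).add_const (Real.pi / 2 - c * L) |>.congr_deriv (mul_one c)
  have hsin : ∀ x ∈ Set.Icc 0 L, 0 < Real.sin (θ x) := fun x hx => by
    have : c * x ≤ c * L := by gcongr; exact hx.2
    have : 0 ≤ c * x := mul_nonneg hc.le hx.1
    exact Real.sin_pos_of_pos_of_lt_pi (by simp only [hθ]; linarith)
      (by simp only [hθ]; linarith [Real.pi_pos])
  set lam : ℝ → ℝ := fun x => c * (Real.cos (θ x) / Real.sin (θ x)) with hlam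
  have hlamd : ∀ x ∈ Set.Icc 0 L, HasDerivAt lam (-c ^ 2 - lam x ^ 2) x := fun x hx => by
    have hs := (hsin x hx).ne'
    have := ((hθd x).cos.div (hθd x).sin hs).const_mul c
    refine this.congr_deriv ?_
    simp only [hlam]
    field_simp
  have hN : ∀ x, HasDerivAt (fun x => ‖g x‖ ^ 2) (2 * inner ℝ (g x) (g' x)) x :=
    fun x => (hg x).norm_sq
  have hF : ∀ x ∈ Set.Icc 0 L, HasDerivAt (fun x => lam x * ‖g x‖ ^ 2)
      ((-c ^ 2 - lam x ^ 2) * ‖g x‖ ^ 2 + lam x * (2 * inner ℝ (g x) (g' x))) x :=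
    fun x hx => (hlamd x hx).mul (hN x)
  have key := intervalIntegral.sub_le_integral_of_hasDeriv_right_of_le
    (φ := fun x => ‖g' x‖ ^ 2 - c ^ 2 * ‖g x‖ ^ 2) hL.le
    (fun x hx => (hF x hx).continuousAt.continuousWithinAt)
    (fun x hx => (hF x ⟨hx.1.le, hx.2.le⟩).hasDerivWithinAt)
    (by
      refine Continuous.integrableOn_Icc ?_
      fun_prop)
    -- Completing the square: `(lam ‖g‖²)' = ‖g'‖² - c² ‖g‖² - ‖g' - lam g‖²`. The boundary terms
    -- vanish, at `0` by `g 0 = 0` and at `L` by `lam L = 0`.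
    (fun x _ => by
      have h := norm_sub_sq_real (g' x) (lam x • g x)
      have h1 : 0 ≤ ‖g' x - lam x • g x‖ ^ 2 := by positivity
      rw [inner_smul_right, norm_smul, mul_pow, Real.norm_eq_abs, sq_abs,
        real_inner_comm] at h
      nlinarith)
  have hend : lam L = 0 := by simp [hlam, hθ]
  rw [hend, h0] at key
  have i1 : IntervalIntegrable (fun x => ‖g' x‖ ^ 2) volume 0 L :=
    Continuous.intervalIntegrable (by fun_prop) _ _
  have i2 : IntervalIntegrable (fun x => c ^ 2 * ‖g x‖ ^ 2) volume 0 L :=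
    Continuous.intervalIntegrable (by fun_prop) _ _
  rw [intervalIntegral.integral_sub i1 i2, intervalIntegral.integral_const_mul] at key
  simpa using key

/-- Wirtinger's inequality for the oscillation around the midpoint of an interval. -/
lemma wirtinger_midpoint {f D : ℝ → ℂ} (hf : ∀ x, HasDerivAt f (D x) x) (hD : Continuous D)
    (x₀ : ℝ) {c L : ℝ} (hc : 0 < c) (hL : 0 < L) (hcL : c * L < Real.pi / 2) :
    c ^ 2 * ∫ x in (x₀ - L)..(x₀ + L), ‖f x - f x₀‖ ^ 2 ≤
      ∫ x in (x₀ - L)..(x₀ + L), ‖D x‖ ^ 2 := by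
  have hfc : Continuous f := continuous_iff_continuousAt.2 fun x => (hf x).continuousAt
  have r := wirtinger_of_zero_left (g := fun t => f (x₀ + t) - f x₀) (g' := fun t => D (x₀ + t))
    (fun t => by simpa using ((hf (x₀ + t)).comp_const_add x₀ t).sub_const (f x₀))
    (by fun_prop) (by simp) hc hL hcL
  have l := wirtinger_of_zero_left (g := fun t => f (x₀ - t) - f x₀) (g' := fun t => -D (x₀ - t))
    (fun t => by simpa using ((hf (x₀ - t)).comp_const_sub x₀ t).sub_const (f x₀))
    (by fun_prop) (by simp) hc hL hcL
  simp only [norm_neg] at l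
  rw [intervalIntegral.integral_comp_add_left (fun x => ‖f x - f x₀‖ ^ 2),
    intervalIntegral.integral_comp_add_left (fun x => ‖D x‖ ^ 2)] at r
  rw [intervalIntegral.integral_comp_sub_left (fun x => ‖f x - f x₀‖ ^ 2),
    intervalIntegral.integral_comp_sub_left (fun x => ‖D x‖ ^ 2)] at l
  simp only [add_zero, sub_zero] at r l
  have c1 : Continuous fun x => ‖f x - f x₀‖ ^ 2 := by fun_prop
  have c2 : Continuous fun x => ‖D x‖ ^ 2 := by fun_prop
  rw [← intervalIntegral.integral_add_adjacent_intervals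
      (c1.intervalIntegrable (x₀ - L) x₀) (c1.intervalIntegrable x₀ (x₀ + L)),
    ← intervalIntegral.integral_add_adjacent_intervals
      (c2.intervalIntegrable (x₀ - L) x₀) (c2.intervalIntegrable x₀ (x₀ + L))]
  linarith

lemma setLIntegral_Ioc_eq_ofReal {F : ℝ → ℝ} (hF : Continuous F) (h0 : ∀ x, 0 ≤ F x) {a b : ℝ}
    (hab : a ≤ b) :
    ∫⁻ x in Set.Ioc a b, ENNReal.ofReal (F x) = ENNReal.ofReal (∫ x in a..b, F x) := by
  rw [intervalIntegral.integral_of_le hab,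
    ofReal_integral_eq_lintegral_ofReal hF.integrableOn_Ioc (Eventually.of_forall h0)]

/-- A small `τ` keeps the coefficient of `‖a - b‖ ^ 2` close to `1`, so the sharp Wirtinger constant
is not wasted. -/
lemma norm_sq_le_add {τ : ℝ} (hτ : 0 < τ) (a b : ℂ) :
    ‖a‖ ^ 2 ≤ (1 + τ) * ‖a - b‖ ^ 2 + (1 + τ⁻¹) * ‖b‖ ^ 2 := by
  have h1 : ‖a‖ ≤ ‖a - b‖ + ‖b‖ := by simpa using norm_add_le (a - b) b
  have h2 : ‖a‖ ^ 2 ≤ (‖a - b‖ + ‖b‖) ^ 2 := by gcongr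
  have h3 : 0 ≤ (τ * ‖a - b‖ - ‖b‖) ^ 2 / τ := by positivity
  have h4 : (τ * ‖a - b‖ - ‖b‖) ^ 2 / τ =
      τ * ‖a - b‖ ^ 2 + τ⁻¹ * ‖b‖ ^ 2 - 2 * ‖a - b‖ * ‖b‖ := by
    field_simp
    ring
  nlinarith

/-- Wirtinger controls `f - f x₀` by `D`. The first estimate keeps `τ` free for the lower frame
bound; the second takes `τ = 1`, since the upper frame bound needs no sharp constant. -/
lemma local_sampling {f D : ℝ → ℂ} (hf : ∀ x, HasDerivAt f (D x) x) (hD : Continuous D)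
    (x₀ : ℝ) {c L τ : ℝ} (hc : 0 < c) (hL : 0 < L) (hcL : c * L < Real.pi / 2) (hτ : 0 < τ) :
    ∫⁻ x in Set.Ioc (x₀ - L) (x₀ + L), ENNReal.ofReal (‖f x‖ ^ 2) ≤
        ENNReal.ofReal ((1 + τ) / c ^ 2) *
          (∫⁻ x in Set.Ioc (x₀ - L) (x₀ + L), ENNReal.ofReal (‖D x‖ ^ 2)) +
        ENNReal.ofReal ((1 + τ⁻¹) * (2 * L)) * ENNReal.ofReal (‖f x₀‖ ^ 2) ∧
      ENNReal.ofReal (2 * L) * ENNReal.ofReal (‖f x₀‖ ^ 2) ≤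
        ENNReal.ofReal (2 / c ^ 2) *
          (∫⁻ x in Set.Ioc (x₀ - L) (x₀ + L), ENNReal.ofReal (‖D x‖ ^ 2)) +
        2 * ∫⁻ x in Set.Ioc (x₀ - L) (x₀ + L), ENNReal.ofReal (‖f x‖ ^ 2) := by
  have hfc : Continuous f := continuous_iff_continuousAt.2 fun x => (hf x).continuousAt
  have hW := wirtinger_midpoint hf hD x₀ hc hL hcL
  have hle : x₀ - L ≤ x₀ + L := by linarith
  rw [setLIntegral_Ioc_eq_ofReal (by fun_prop) (fun x => by positivity) hle,
    setLIntegral_Ioc_eq_ofReal (by fun_prop) (fun x => by positivity) hle]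
  have iD : 0 ≤ ∫ x in (x₀ - L)..(x₀ + L), ‖D x‖ ^ 2 :=
    intervalIntegral.integral_nonneg hle fun x _ => by positivity
  have iF : 0 ≤ ∫ x in (x₀ - L)..(x₀ + L), ‖f x‖ ^ 2 :=
    intervalIntegral.integral_nonneg hle fun x _ => by positivity
  have hconst : ∫ x in (x₀ - L)..(x₀ + L), ‖f x₀‖ ^ 2 = 2 * L * ‖f x₀‖ ^ 2 := by
    rw [intervalIntegral.integral_const, smul_eq_mul]
    ring
  have c1 : Continuous fun x => ‖f x - f x₀‖ ^ 2 := by fun_prop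
  have c2 : Continuous fun x => ‖f x‖ ^ 2 := by fun_prop
  have c3 : Continuous fun _ : ℝ => ‖f x₀‖ ^ 2 := by fun_prop
  have hW' : ∫ x in (x₀ - L)..(x₀ + L), ‖f x - f x₀‖ ^ 2 ≤
      (∫ x in (x₀ - L)..(x₀ + L), ‖D x‖ ^ 2) / c ^ 2 := by
    rw [le_div_iff₀ (by positivity)]
    linarith
  constructor
  · rw [← ENNReal.ofReal_mul (by positivity), ← ENNReal.ofReal_mul (by positivity),
      ← ENNReal.ofReal_add (by positivity) (by positivity)]
    refine ENNReal.ofReal_le_ofReal ?_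
    have := intervalIntegral.integral_mono_on (μ := volume) hle (c2.intervalIntegrable _ _)
      (((c1.intervalIntegrable _ _).const_mul (1 + τ)).add
        ((c3.intervalIntegrable _ _).const_mul (1 + τ⁻¹)))
      fun x _ => norm_sq_le_add hτ (f x) (f x₀)
    rw [intervalIntegral.integral_add ((c1.intervalIntegrable _ _).const_mul (1 + τ))
        ((c3.intervalIntegrable _ _).const_mul (1 + τ⁻¹)),
      intervalIntegral.integral_const_mul, intervalIntegral.integral_const_mul, hconst] at this
    have h2 := mul_le_mul_of_nonneg_left hW' (by positivity : 0 ≤ 1 + τ)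
    rw [div_mul_eq_mul_div, ← mul_div_assoc] at *
    linarith
  · rw [show (2 : ℝ≥0∞) = ENNReal.ofReal 2 by simp, ← ENNReal.ofReal_mul (by positivity),
      ← ENNReal.ofReal_mul (by positivity), ← ENNReal.ofReal_mul (by positivity),
      ← ENNReal.ofReal_add (by positivity) (by positivity)]
    refine ENNReal.ofReal_le_ofReal ?_
    have := intervalIntegral.integral_mono_on (μ := volume) hle (c3.intervalIntegrable _ _)
      (((c1.intervalIntegrable _ _).const_mul 2).add ((c2.intervalIntegrable _ _).const_mul 2))
      fun x _ => by
        have := norm_sq_le_add one_pos (f x₀) (f x)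
        rw [norm_sub_rev] at this
        norm_num at this
        exact this
    rw [intervalIntegral.integral_add ((c1.intervalIntegrable _ _).const_mul 2)
        ((c2.intervalIntegrable _ _).const_mul 2),
      intervalIntegral.integral_const_mul, intervalIntegral.integral_const_mul, hconst] at this
    have h2 := mul_le_mul_of_nonneg_left hW' (by positivity : (0 : ℝ) ≤ 2)
    rw [div_mul_eq_mul_div]
    rw [← mul_div_assoc] at h2
    linarith

/-- A Lebesgue integral over the line as the sum of the integrals over a tiling. -/
lemma lintegral_eq_tsum_Ioc (F : ℝ → ℝ≥0∞) {p : ℝ} (hp : 0 < p) (a : ℝ) :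
    ∫⁻ x, F x = ∑' k : ℤ, ∫⁻ x in Set.Ioc (a + k * p) (a + (k + 1) * p), F x := by
  have hU := iUnion_Ioc_add_zsmul hp a
  have hdisj := Set.pairwise_disjoint_Ioc_add_zsmul a p
  simp only [zsmul_eq_mul, Int.cast_add, Int.cast_one] at hU hdisj
  rw [← setLIntegral_univ, ← hU, lintegral_iUnion (fun _ => measurableSet_Ioc) hdisj]

/-- Periodization of a Lebesgue integral. -/
lemma lintegral_eq_lintegral_tsum {F : ℝ → ℝ≥0∞} (hF : Measurable F) :
    ∫⁻ x, F x = ∫⁻ x in Set.Ioc (0 : ℝ) 1, ∑' l : ℤ, F (x + l) := by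
  rw [lintegral_eq_tsum_Ioc F one_pos 0, lintegral_tsum fun l => by fun_prop]
  refine tsum_congr fun l => ?_
  have h := (measurePreserving_add_right volume (l : ℝ)).setLIntegral_comp_preimage
    (measurableSet_Ioc (a := (0 : ℝ) + l * 1) (b := 0 + (l + 1) * 1)) hF
  rw [← h]
  congr 2
  ext x
  simp only [Set.mem_preimage, Set.mem_Ioc]
  constructor <;> rintro ⟨h1, h2⟩ <;> constructor <;> linarith

/-- Sampling inequalities on the lattice `x₀ - α ℤ` for a differentiable function. -/
lemma sampling_inequalities {f D : ℝ → ℂ} (hf : ∀ x, HasDerivAt f (D x) x) (hD : Continuous D)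
    (x₀ : ℝ) {c α τ : ℝ} (hc : 0 < c) (hα : 0 < α) (hcα : c * α < Real.pi) (hτ : 0 < τ) :
    ∫⁻ x, ENNReal.ofReal (‖f x‖ ^ 2) ≤
        ENNReal.ofReal ((1 + τ) / c ^ 2) * (∫⁻ x, ENNReal.ofReal (‖D x‖ ^ 2)) +
        ENNReal.ofReal ((1 + τ⁻¹) * α) * ∑' k : ℤ, ENNReal.ofReal (‖f (x₀ - α * k)‖ ^ 2) ∧
      ENNReal.ofReal α * ∑' k : ℤ, ENNReal.ofReal (‖f (x₀ - α * k)‖ ^ 2) ≤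
        ENNReal.ofReal (2 / c ^ 2) * (∫⁻ x, ENNReal.ofReal (‖D x‖ ^ 2)) +
        2 * ∫⁻ x, ENNReal.ofReal (‖f x‖ ^ 2) := by
  have tile : ∀ F : ℝ → ℝ≥0∞, ∫⁻ x, F x =
      ∑' k : ℤ, ∫⁻ x in Set.Ioc (x₀ - α * k - α / 2) (x₀ - α * k + α / 2), F x := by
    intro F
    rw [lintegral_eq_tsum_Ioc F hα (x₀ - α / 2), ← (Equiv.neg ℤ).tsum_eq]
    refine tsum_congr fun k => ?_
    simp only [Equiv.neg_apply]
    push_cast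
    ring_nf
  have loc := fun k : ℤ => local_sampling hf hD (x₀ - α * k) hc (half_pos hα)
    (by linarith) hτ
  rw [show 2 * (α / 2) = α by ring] at loc
  rw [tile, tile fun x => ENNReal.ofReal (‖D x‖ ^ 2)]
  simp only [← ENNReal.tsum_mul_left, ← ENNReal.tsum_add]
  exact ⟨ENNReal.tsum_le_tsum fun k => (loc k).1, ENNReal.tsum_le_tsum fun k => (loc k).2⟩

/-! ### Fourier series, trigonometric polynomials and periodization. -/

/-- Parseval's identity on the unit interval. -/
lemma tsum_norm_sq_integral_exp_mul {f : ℝ → ℂ} (hf : Continuous f) :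
    ∑' m : ℤ, ENNReal.ofReal
        (‖∫ x in (0 : ℝ)..1, Complex.exp (-(2 * Real.pi * Complex.I * m * x)) * f x‖ ^ 2) =
      ∫⁻ x in Set.Ioc (0 : ℝ) 1, ENNReal.ofReal (‖f x‖ ^ 2) := by
  have hmem : MemLp f 2 (volume.restrict (Set.Ioc (0 : ℝ) 1)) := by
    obtain ⟨C, hC⟩ := (isCompact_Icc (a := (0 : ℝ)) (b := 1)).exists_bound_of_continuousOn
      hf.continuousOn
    refine MemLp.of_bound hf.aestronglyMeasurable C ?_
    filter_upwards [ae_restrict_mem measurableSet_Ioc] with x hx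
    exact hC x ⟨hx.1.le, hx.2⟩
  have h := hasSum_sq_fourierCoeffOn zero_lt_one hmem
  rw [sub_zero, inv_one, one_smul] at h
  rw [setLIntegral_Ioc_eq_ofReal (by fun_prop) (fun x => by positivity) zero_le_one, ← h.tsum_eq,
    ENNReal.ofReal_tsum_of_nonneg (fun m => by positivity) h.summable]
  refine tsum_congr fun m => ?_
  rw [fourierCoeffOn_eq_integral]
  simp only [sub_zero, div_one, one_smul, fourier_coe_apply, smul_eq_mul]
  congr 4 with x
  congr 2
  push_cast
  ring

lemma integral_exp_mul_exp (m n : ℤ) :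
    ∫ x in (0 : ℝ)..1, Complex.exp (-(2 * Real.pi * Complex.I * m * x)) *
      Complex.exp (2 * Real.pi * Complex.I * n * x) = if m = n then 1 else 0 := by
  have h := congrFun (fourierCoeff_fourier (T := (1 : ℝ)) n) m
  rw [fourierCoeff_eq_intervalIntegral _ m 0, Pi.single_apply] at h
  rw [← h]
  simp only [zero_add, div_one, one_smul, fourier_coe_apply, smul_eq_mul]
  congr 1 with x
  congr 2
  · push_cast
    ring
  · push_cast
    ring

/-- The trigonometric polynomial with coefficients `c n`, `n ∈ s`. -/
noncomputable def trigPoly (s : Finset ℤ) (c : ℤ → ℂ) (w : ℝ) : ℂ :=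
  ∑ n ∈ s, c n * Complex.exp (2 * Real.pi * Complex.I * n * w)

lemma continuous_trigPoly (s : Finset ℤ) (c : ℤ → ℂ) : Continuous (trigPoly s c) := by
  unfold trigPoly
  fun_prop

lemma trigPoly_add_int (s : Finset ℤ) (c : ℤ → ℂ) (w : ℝ) (l : ℤ) :
    trigPoly s c (w + l) = trigPoly s c w := by
  refine Finset.sum_congr rfl fun n _ => ?_
  congr 1
  refine Complex.exp_eq_exp_iff_exists_int.2 ⟨n * l, ?_⟩
  push_cast
  ring

lemma norm_trigPoly_le (s : Finset ℤ) (c : ℤ → ℂ) (w : ℝ) :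
    ‖trigPoly s c w‖ ≤ ∑ n ∈ s, ‖c n‖ := by
  refine (norm_sum_le _ _).trans (Finset.sum_le_sum fun n _ => ?_)
  rw [norm_mul, show (2 * Real.pi * Complex.I * n * w : ℂ) =
    ((2 * Real.pi * n * w : ℝ) : ℂ) * Complex.I by push_cast; ring,
    Complex.norm_exp_ofReal_mul_I, mul_one]

lemma lintegral_norm_sq_trigPoly (s : Finset ℤ) (c : ℤ → ℂ) :
    ∫⁻ w in Set.Ioc (0 : ℝ) 1, ENNReal.ofReal (‖trigPoly s c w‖ ^ 2) =
      ∑ n ∈ s, ENNReal.ofReal (‖c n‖ ^ 2) := by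
  have coeff : ∀ m : ℤ, ∫ x in (0 : ℝ)..1,
      Complex.exp (-(2 * Real.pi * Complex.I * m * x)) * trigPoly s c x =
        if m ∈ s then c m else 0 := by
    intro m
    simp only [trigPoly, Finset.mul_sum]
    rw [intervalIntegral.integral_finsetSum
      fun n _ => Continuous.intervalIntegrable (by fun_prop) _ _]
    simp only [mul_left_comm _ (c _), intervalIntegral.integral_const_mul, integral_exp_mul_exp]
    simp
  rw [← tsum_norm_sq_integral_exp_mul (continuous_trigPoly s c)]
  simp only [coeff]
  rw [tsum_eq_sum (s := s) fun n hn => by simp [hn]]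
  exact Finset.sum_congr rfl fun n hn => by simp [hn]

/-- Parseval's identity for the periodization of a function, as a finite sum of translates. -/
lemma tsum_norm_sq_fourier_int {g : ℝ → ℂ} (hg : Continuous g) (hgi : Integrable g)
    {s : Finset ℤ} (hs : ∀ x ∈ Set.Icc (0 : ℝ) 1, ∀ n ∉ s, g (x + n) = 0) :
    ∑' m : ℤ, ENNReal.ofReal (‖𝓕 g m‖ ^ 2) =
      ∫⁻ x in Set.Ioc (0 : ℝ) 1, ENNReal.ofReal (‖∑ n ∈ s, g (x + n)‖ ^ 2) := by
  rw [← tsum_norm_sq_integral_exp_mul (f := fun x => ∑ n ∈ s, g (x + n)) (by fun_prop)]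
  refine tsum_congr fun m => ?_
  congr 3
  set G : ℝ → ℂ := fun x => Complex.exp (-(2 * Real.pi * Complex.I * m * x)) * g x with hG
  have hGF : 𝓕 g m = ∫ x, G x := by
    rw [Real.fourier_real_eq_integral_exp_smul]
    congr 1 with x
    simp only [hG, smul_eq_mul]
    congr 2
    push_cast
    ring
  have hGi : Integrable G := by
    refine hgi.bdd_mul (c := 1) (Continuous.aestronglyMeasurable (by fun_prop))
      (Eventually.of_forall fun x => ?_)
    rw [show (-(2 * Real.pi * Complex.I * m * x) : ℂ) =
      ((-(2 * Real.pi * m * x) : ℝ) : ℂ) * Complex.I by push_cast; ring,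
      Complex.norm_exp_ofReal_mul_I]
  -- As `m` is an integer the exponential is 1-periodic, so `𝓕 g m` is a Fourier coefficient of the
  -- periodization of `g`.
  have hGn : ∀ (x : ℝ) (n : ℤ), G (x + n) =
      Complex.exp (-(2 * Real.pi * Complex.I * m * x)) * g (x + n) := by
    intro x n
    simp only [hG]
    congr 1
    refine Complex.exp_eq_exp_iff_exists_int.2 ⟨-(m * n), ?_⟩
    push_cast
    ring
  rw [hGF, ← hGi.hasSum_intervalIntegral_comp_add_int.tsum_eq, tsum_eq_sum (s := s),
    ← intervalIntegral.integral_finsetSum]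
  · simp only [hGn, Finset.mul_sum]
  · intro n _
    refine Continuous.intervalIntegrable ?_ _ _
    simp only [hG]
    fun_prop
  · intro n hn
    rw [intervalIntegral.integral_congr (g := fun _ => (0 : ℂ)), intervalIntegral.integral_zero]
    intro x hx
    rw [Set.uIcc_of_le zero_le_one] at hx
    simp only [hGn, hs x hx n hn, mul_zero]

/-! ### Stable sampling of combinations of integer translates. -/

lemma GaussianDecay.norm_le {a : ℝ} {H : ℝ → ℂ} (hG : GaussianDecay a fun w => ‖H w‖ ^ 2)
    (w : ℝ) : ‖H w‖ ≤ Real.exp (-(a / 2) * w ^ 2) * ‖H 0‖ := by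
  refine abs_le_of_sq_le_sq' ?_ (by positivity) |>.2
  refine (hG.le 0 w (by simp)).trans (le_of_eq ?_)
  rw [mul_pow, ← Real.exp_nat_mul]
  congr 2
  push_cast
  ring

lemma GaussianDecay.integrable {a : ℝ} (ha : 0 < a) {H : ℝ → ℂ} (hH : Continuous H)
    (hG : GaussianDecay a fun w => ‖H w‖ ^ 2) :
    Integrable H ∧ Integrable fun w : ℝ => w • H w := by
  constructor
  · exact ((integrable_exp_neg_mul_sq (half_pos ha)).mul_const ‖H 0‖).mono'
      hH.aestronglyMeasurable (Eventually.of_forall hG.norm_le)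
  · refine ((integrable_mul_exp_neg_mul_sq (half_pos ha)).norm.mul_const ‖H 0‖).mono'
      (by fun_prop) (Eventually.of_forall fun w => ?_)
    rw [norm_smul, norm_mul, mul_assoc, Real.norm_eq_abs (Real.exp _), Real.abs_exp]
    gcongr
    exact hG.norm_le w

/-- The finite linear combination `∑ c n ψ(t + n)` of integer translates. -/
noncomputable def shiftComb (ψ : ℝ → ℂ) (s : Finset ℤ) (c : ℤ → ℂ) (t : ℝ) : ℂ :=
  ∑ n ∈ s, c n * ψ (t + n)

lemma fourier_shiftComb {ψ : ℝ → ℂ} (hψ : Integrable ψ) (s : Finset ℤ) (c : ℤ → ℂ) (w : ℝ) :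
    𝓕 (shiftComb ψ s c) w = trigPoly s c w * 𝓕 ψ w := by
  have h : 𝓕 (shiftComb ψ s c) w = ∑ n ∈ s, c n * 𝓕 (fun t => ψ (t + n)) w := by
    simp only [Real.fourier_eq, shiftComb, Circle.smul_def, smul_eq_mul, Finset.mul_sum]
    rw [integral_finsetSum]
    · refine Finset.sum_congr rfl fun n _ => ?_
      rw [← integral_const_mul]
      congr 1 with x
      ring
    · intro n _
      have := ((Real.fourierIntegral_convergent_iff w).2 (hψ.comp_add_right (n : ℝ))).const_mul
        (c n)
      refine this.congr (Eventually.of_forall fun x => ?_)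
      simp only [Circle.smul_def, smul_eq_mul]
      ring
  rw [h, trigPoly, Finset.sum_mul]
  refine Finset.sum_congr rfl fun n _ => ?_
  rw [fourier_comp_add, ← mul_assoc]
  congr 3
  push_cast
  ring

/-- `ofReal`-valued weighted integrals of `|trigPoly * H|²`, folded to the unit interval. -/
lemma lintegral_norm_sq_trigPoly_mul (s : Finset ℤ) (c : ℤ → ℂ) {F : ℝ → ℝ}
    (hF : Continuous F) :
    ∫⁻ w, ENNReal.ofReal (‖trigPoly s c w‖ ^ 2) * ENNReal.ofReal (F w) =
      ∫⁻ w in Set.Ioc (0 : ℝ) 1, ENNReal.ofReal (‖trigPoly s c w‖ ^ 2) *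
        ∑' l : ℤ, ENNReal.ofReal (F (w + l)) := by
  have hT := (continuous_trigPoly s c).measurable
  have hFm := hF.measurable
  rw [lintegral_eq_lintegral_tsum (by fun_prop)]
  refine lintegral_congr fun w => ?_
  simp only [trigPoly_add_int, ENNReal.tsum_mul_left]

/-- Sampling a finite combination of integer translates of `ψ` on `x₀ - α ℤ` is stable, uniformly
in `x₀` and in the combination. -/
lemma exists_sampling_bounds {ψ : ℝ → ℂ} (hψc : Continuous ψ) (hψ : Integrable ψ) {a α : ℝ}
    (ha : 2 * Real.pi ≤ a) (hG : GaussianDecay a fun w => ‖𝓕 ψ w‖ ^ 2) (hα : 0 < α)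
    (hM : 4 * α ^ 2 * (1 / 4 + 2 / a * tailConst) < 1) :
    ∃ A B : ℝ, 0 < A ∧ 0 < B ∧ ∀ (s : Finset ℤ) (c : ℤ → ℂ) (x₀ : ℝ),
      ENNReal.ofReal A * ∑ n ∈ s, ENNReal.ofReal (‖c n‖ ^ 2) ≤
        ∑' k : ℤ, ENNReal.ofReal (‖shiftComb ψ s c (x₀ - α * k)‖ ^ 2) ∧
      ∑' k : ℤ, ENNReal.ofReal (‖shiftComb ψ s c (x₀ - α * k)‖ ^ 2) ≤
        ENNReal.ofReal B * ∑ n ∈ s, ENNReal.ofReal (‖c n‖ ^ 2) := by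
  have ha0 : 0 < a := by linarith [Real.pi_pos]
  set M := 1 / 4 + 2 / a * tailConst with hMdef
  have hM0 : 0 < M := by
    have := tailConst_nonneg
    positivity
  set X := 4 * Real.pi ^ 2 * M with hX
  have hX0 : 0 < X := by positivity
  -- `X` will bound `‖f'‖² / ‖f‖²`, and `hM` says that `X < (π/α)²`, the Wirtinger threshold for
  -- spacing `α`. An intermediate `r = cc²` leaves room on both sides.
  obtain ⟨r, hXr, hr⟩ : ∃ r, X < r ∧ r < (Real.pi / α) ^ 2 := exists_between (by
    rw [div_pow, lt_div_iff₀ (by positivity)]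
    nlinarith [sq_pos_of_pos Real.pi_pos])
  have hr0 : 0 < r := hX0.trans hXr
  -- Chosen so that `(1 + τ) X` is the midpoint of `X` and `r`, whence `q < 1`.
  set τ := (r - X) / (2 * X) with hτ
  have hτ0 : 0 < τ := div_pos (by linarith) (by linarith)
  set q := (1 + τ) * X / r with hq
  have hq1 : q < 1 := by
    rw [hq, div_lt_one hr0]
    have : (1 + τ) * X = (r + X) / 2 := by
      rw [hτ]
      field_simp
      ring
    linarith
  have hq0 : 0 ≤ q := by positivity
  set cc := Real.sqrt r with hcc
  have hcc0 : 0 < cc := Real.sqrt_pos.2 hr0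
  have hcc2 : cc ^ 2 = r := Real.sq_sqrt hr0.le
  have hccα : cc * α < Real.pi := by
    rw [← lt_div_iff₀ hα]
    exact (Real.sqrt_lt' (by positivity)).2 hr
  have hmpos : 0 < ‖𝓕 ψ 1‖ ^ 2 := hG.pos 1
  have hSpos : 0 < ‖𝓕 ψ 0‖ ^ 2 := hG.pos 0
  have hKpos : 0 < tailConst + 1 := by linarith [tailConst_nonneg]
  have hHc : Continuous (𝓕 ψ) := hψ.continuous_fourier
  obtain ⟨hHi, hwHi⟩ := hG.integrable ha0 hHc
  have ha1 : 2 * Real.pi ≤ a * 1 ^ 2 := by simpa using ha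
  refine ⟨(1 - q) * ‖𝓕 ψ 1‖ ^ 2 / ((1 + τ⁻¹) * α),
    (2 * X / r + 2) * ((tailConst + 1) * ‖𝓕 ψ 0‖ ^ 2) / α,
    div_pos (mul_pos (by linarith) hmpos) (by positivity), by positivity, fun s c x₀ => ?_⟩
  set f := shiftComb ψ s c with hf
  set E := ∑ n ∈ s, ENNReal.ofReal (‖c n‖ ^ 2) with hE
  have hEfin : E ≠ ⊤ := ENNReal.sum_ne_top.2 fun _ _ => ENNReal.ofReal_ne_top
  have hfF : 𝓕 f = fun w => trigPoly s c w * 𝓕 ψ w := funext (fourier_shiftComb hψ s c)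
  have hfc : Continuous f := by
    simp only [hf]
    unfold shiftComb
    fun_prop
  have hfi : Integrable f := by
    refine integrable_finsetSum _ fun n _ => (hψ.comp_add_right (n : ℝ)).const_mul _
  have hTb : ∀ᵐ w : ℝ, ‖trigPoly s c w‖ ≤ ∑ n ∈ s, ‖c n‖ :=
    Eventually.of_forall (norm_trigPoly_le s c)
  have hTm : AEStronglyMeasurable (trigPoly s c) :=
    (continuous_trigPoly s c).aestronglyMeasurable
  have hFi : Integrable (𝓕 f) := by
    rw [hfF]
    exact hHi.bdd_mul hTm hTb
  have hwFi : Integrable fun w : ℝ => w • 𝓕 f w := by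
    refine (hwHi.bdd_mul hTm hTb).congr (Eventually.of_forall fun w => ?_)
    simp only [hfF, Complex.real_smul]
    ring
  obtain ⟨D, hDc, hD, hDle⟩ := exists_deriv_of_integrable_fourier hfc hfi hFi hwFi
  set N := ∫⁻ x, ENNReal.ofReal (‖f x‖ ^ 2) with hN
  set V := ∫⁻ x, ENNReal.ofReal (‖D x‖ ^ 2) with hV
  have hNeq : N = ∫⁻ w in Set.Ioc (0 : ℝ) 1, ENNReal.ofReal (‖trigPoly s c w‖ ^ 2) *
      ∑' l : ℤ, ENNReal.ofReal (‖𝓕 ψ (w + l)‖ ^ 2) := by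
    rw [hN, lintegral_norm_sq_fourier hfc hfi hFi,
      ← lintegral_norm_sq_trigPoly_mul s c (F := fun w => ‖𝓕 ψ w‖ ^ 2) (by fun_prop)]
    refine lintegral_congr fun w => ?_
    rw [hfF, norm_mul, mul_pow, ENNReal.ofReal_mul (by positivity)]
  have hlow : ENNReal.ofReal (‖𝓕 ψ 1‖ ^ 2) * E ≤ N := by
    rw [hNeq, hE, ← lintegral_norm_sq_trigPoly, mul_comm,
      ← lintegral_mul_const' _ _ ENNReal.ofReal_ne_top]
    refine lintegral_mono fun w => ?_
    gcongr
    simpa using hG.le_tsum ha0 one_pos w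
  have hup : N ≤ ENNReal.ofReal ((tailConst + 1) * ‖𝓕 ψ 0‖ ^ 2) * E := by
    rw [hNeq, hE, ← lintegral_norm_sq_trigPoly, mul_comm,
      ← lintegral_mul_const' _ _ ENNReal.ofReal_ne_top]
    refine lintegral_mono fun w => ?_
    gcongr
    refine le_trans (by simpa using hG.tsum_le ha0 one_pos ha1 w) (ENNReal.ofReal_le_ofReal ?_)
    gcongr
    linarith
  have hNfin : N ≠ ⊤ := ne_top_of_le_ne_top (ENNReal.mul_ne_top ENNReal.ofReal_ne_top hEfin) hup
  -- The trigonometric polynomial is 1-periodic, so the weight `w²` can be estimated on each coset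
  -- of `ℤ` by `GaussianDecay.tsum_sq_mul_le`.
  have hVN : V ≤ ENNReal.ofReal X * N := by
    have h1 : ∫⁻ w, ENNReal.ofReal (w ^ 2 * ‖𝓕 f w‖ ^ 2) ≤ ENNReal.ofReal M * N := by
      have e : ∀ w, ENNReal.ofReal (w ^ 2 * ‖𝓕 f w‖ ^ 2) =
          ENNReal.ofReal (‖trigPoly s c w‖ ^ 2) * ENNReal.ofReal (w ^ 2 * ‖𝓕 ψ w‖ ^ 2) := by
        intro w
        rw [← ENNReal.ofReal_mul (by positivity), hfF, norm_mul, mul_pow]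
        ring_nf
      simp only [e]
      rw [lintegral_norm_sq_trigPoly_mul s c (F := fun w => w ^ 2 * ‖𝓕 ψ w‖ ^ 2) (by fun_prop),
        hNeq, ← lintegral_const_mul' _ _ ENNReal.ofReal_ne_top]
      refine lintegral_mono fun w => ?_
      rw [mul_left_comm]
      gcongr
      simpa [hMdef] using hG.tsum_sq_mul_le ha0 one_pos ha1 w
    refine hDle.trans ?_
    rw [hX, ENNReal.ofReal_mul (p := 4 * Real.pi ^ 2) (by positivity), mul_assoc]
    exact mul_le_mul' le_rfl h1
  obtain ⟨S1, S2⟩ := sampling_inequalities hD hDc x₀ hcc0 hα hccα hτ0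
  rw [hcc2, ← hN, ← hV] at S1 S2
  set R := ∑' k : ℤ, ENNReal.ofReal (‖f (x₀ - α * k)‖ ^ 2) with hR
  constructor
  · have h1 : N ≤ ENNReal.ofReal q * N + ENNReal.ofReal ((1 + τ⁻¹) * α) * R := by
      refine S1.trans (add_le_add ?_ le_rfl)
      calc ENNReal.ofReal ((1 + τ) / r) * V ≤
          ENNReal.ofReal ((1 + τ) / r) * (ENNReal.ofReal X * N) := by gcongr
        _ = ENNReal.ofReal q * N := by
          rw [← mul_assoc, ← ENNReal.ofReal_mul (by positivity), hq, div_mul_eq_mul_div]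
    -- Finiteness of `N` allows `q N` to be absorbed into the left side.
    have h2 : ENNReal.ofReal (1 - q) * N ≤ ENNReal.ofReal ((1 + τ⁻¹) * α) * R := by
      rw [ENNReal.ofReal_sub _ hq0, ENNReal.ofReal_one, ENNReal.sub_mul (fun _ _ => hNfin),
        one_mul]
      exact tsub_le_iff_left.2 h1
    rw [div_eq_mul_inv, mul_comm _ ((1 + τ⁻¹) * α)⁻¹, ENNReal.ofReal_mul (by positivity),
      ENNReal.ofReal_mul (by linarith), ENNReal.ofReal_inv_of_pos (by positivity), mul_assoc,
      mul_assoc, ENNReal.inv_mul_le_iff (by positivity) ENNReal.ofReal_ne_top]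
    exact le_trans (by gcongr) h2
  · rw [div_eq_mul_inv, mul_comm _ α⁻¹, ENNReal.ofReal_mul (by positivity),
      ENNReal.ofReal_mul (by positivity), ENNReal.ofReal_inv_of_pos hα, mul_assoc, mul_assoc,
      ← ENNReal.mul_le_iff_le_inv (by positivity) ENNReal.ofReal_ne_top]
    refine S2.trans ?_
    calc ENNReal.ofReal (2 / r) * V + 2 * N ≤
        ENNReal.ofReal (2 / r) * (ENNReal.ofReal X * N) + 2 * N := by gcongr
      _ = ENNReal.ofReal (2 * X / r + 2) * N := by
        rw [← mul_assoc, ← ENNReal.ofReal_mul (by positivity),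
          ENNReal.ofReal_add (by positivity) (by norm_num), add_mul, div_mul_eq_mul_div]
        simp
      _ ≤ _ := by gcongr

/-! ### Reduction of the frame inequalities to sampling. -/

lemma exists_finset_shift_eq_zero {f : ℝ → ℂ} (hf : HasCompactSupport f) :
    ∃ s : Finset ℤ, ∀ x ∈ Set.Icc (0 : ℝ) 1, ∀ n ∉ s, f (x + n) = 0 := by
  obtain ⟨R, hR⟩ := hf.isBounded.subset_closedBall 0
  refine ⟨Finset.Icc (-⌈R⌉ - 1) ⌈R⌉, fun x hx n hn => ?_⟩
  by_contra h
  have h1 := hR (subset_tsupport f h)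
  rw [mem_closedBall_zero_iff, Real.norm_eq_abs, abs_le] at h1
  have h2 := Int.le_ceil R
  refine hn (Finset.mem_Icc.2 ⟨?_, ?_⟩)
  · have : ((-⌈R⌉ - 1 : ℤ) : ℝ) ≤ n := by
      push_cast
      linarith [hx.2]
    exact_mod_cast this
  · have : (n : ℝ) ≤ (⌈R⌉ : ℤ) := by linarith [hx.1]
    exact_mod_cast this

/-- Frame inequalities on continuous compactly supported functions, for the modulation
parameter `1`. -/
lemma frame_bounds_of_sampling {ψ : ℝ → ℂ} (hψ : Continuous ψ) {α A B : ℝ}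
    (h : ∀ (s : Finset ℤ) (c : ℤ → ℂ) (x₀ : ℝ),
      ENNReal.ofReal A * ∑ n ∈ s, ENNReal.ofReal (‖c n‖ ^ 2) ≤
        ∑' k : ℤ, ENNReal.ofReal (‖shiftComb ψ s c (x₀ - α * k)‖ ^ 2) ∧
      ∑' k : ℤ, ENNReal.ofReal (‖shiftComb ψ s c (x₀ - α * k)‖ ^ 2) ≤
        ENNReal.ofReal B * ∑ n ∈ s, ENNReal.ofReal (‖c n‖ ^ 2))
    {f : ℝ → ℂ} (hf : Continuous f) (hfs : HasCompactSupport f) :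
    ENNReal.ofReal A * ∫⁻ x, ENNReal.ofReal (‖f x‖ ^ 2) ≤
        ∑' p : ℤ × ℤ, ENNReal.ofReal
          (‖∫ x, starRingEnd ℂ (gaborAtom ψ α 1 p x) * f x‖ ^ 2) ∧
      ∑' p : ℤ × ℤ, ENNReal.ofReal
          (‖∫ x, starRingEnd ℂ (gaborAtom ψ α 1 p x) * f x‖ ^ 2) ≤
        ENNReal.ofReal B * ∫⁻ x, ENNReal.ofReal (‖f x‖ ^ 2) := by
  obtain ⟨s, hs⟩ := exists_finset_shift_eq_zero hfs
  set g : ℤ → ℝ → ℂ := fun k x => starRingEnd ℂ (ψ (x - α * k)) * f x with hg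
  have hgc : ∀ k, Continuous (g k) := fun k =>
    (Complex.continuous_conj.comp (by fun_prop)).mul hf
  have hgi : ∀ k, Integrable (g k) := fun k =>
    (hgc k).integrable_of_hasCompactSupport hfs.mul_left
  have hI : ∀ k m : ℤ, ∫ x, starRingEnd ℂ (gaborAtom ψ α 1 (k, m) x) * f x = 𝓕 (g k) m := by
    intro k m
    rw [Real.fourier_real_eq_integral_exp_smul]
    congr 1 with x
    simp only [gaborAtom, hg, smul_eq_mul, map_mul, ← Complex.exp_conj, Complex.conj_I,
      Complex.conj_ofReal, mul_assoc]
    congr 2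
    simp only [map_ofNat, map_intCast, Complex.ofReal_one]
    push_cast
    ring
  have hsum : ∀ (k : ℤ) (x : ℝ), ‖∑ n ∈ s, g k (x + n)‖ =
      ‖shiftComb ψ s (fun n => starRingEnd ℂ (f (x + n))) (x - α * k)‖ := by
    intro k x
    rw [← RCLike.norm_conj, shiftComb, map_sum]
    congr 1
    refine Finset.sum_congr rfl fun n _ => ?_
    simp only [hg, map_mul, Complex.conj_conj]
    rw [mul_comm, show x + n - α * k = x - α * k + n by ring]
  -- For fixed `k`, Parseval in `m` gives the periodization of `g k`. Up to conjugation this is a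
  -- combination of translates of `ψ` with coefficients `conj (f (x + n))`, sampled at `x - αk`;
  -- thus `x` serves as the base point.
  have hS : ∑' p : ℤ × ℤ, ENNReal.ofReal
      (‖∫ x, starRingEnd ℂ (gaborAtom ψ α 1 p x) * f x‖ ^ 2) =
      ∫⁻ x in Set.Ioc (0 : ℝ) 1, ∑' k : ℤ, ENNReal.ofReal
        (‖shiftComb ψ s (fun n => starRingEnd ℂ (f (x + n))) (x - α * k)‖ ^ 2) := by
    rw [ENNReal.tsum_prod']
    simp only [hI]
    simp only [← hsum]
    rw [lintegral_tsum]
    · refine tsum_congr fun k => tsum_norm_sq_fourier_int (hgc k) (hgi k) fun x hx n hn => ?_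
      simp only [hg, hs x hx n hn, mul_zero]
    · intro k
      have : Measurable fun x => ∑ n ∈ s, g k (x + n) :=
        (continuous_finsetSum _ fun n _ => (hgc k).comp (by fun_prop)).measurable
      fun_prop
  have hfm := hf.measurable
  have hN : ∫⁻ x, ENNReal.ofReal (‖f x‖ ^ 2) = ∫⁻ x in Set.Ioc (0 : ℝ) 1,
      ∑ n ∈ s, ENNReal.ofReal (‖starRingEnd ℂ (f (x + n))‖ ^ 2) := by
    rw [lintegral_eq_lintegral_tsum (by fun_prop)]
    refine setLIntegral_congr_fun measurableSet_Ioc fun x hx => ?_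
    simp only [RCLike.norm_conj]
    exact tsum_eq_sum fun n hn => by simp [hs x ⟨hx.1.le, hx.2⟩ n hn]
  rw [hS, hN, ← lintegral_const_mul' _ _ ENNReal.ofReal_ne_top,
    ← lintegral_const_mul' _ _ ENNReal.ofReal_ne_top]
  exact ⟨lintegral_mono fun x => (h s _ x).1, lintegral_mono fun x => (h s _ x).2⟩

/-! ### Rescaling, square integrability and density. -/

/-- Dilation reduces the modulation parameter `β` to `1`. -/
lemma integral_gaborAtom_rescale (φ f : ℝ → ℂ) {α β : ℝ} (hβ : 0 < β) (p : ℤ × ℤ) :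
    ∫ x, starRingEnd ℂ (gaborAtom φ α β p x) * f x =
      ((β⁻¹ * Real.sqrt β : ℝ) : ℂ) *
        ∫ y, starRingEnd ℂ (gaborAtom (dilate φ (1 / β)) (α * β) 1 p y) * f (β⁻¹ * y) := by
  have := Measure.integral_comp_mul_left
    (fun x => starRingEnd ℂ (gaborAtom φ α β p x) * f x) β⁻¹
  rw [inv_inv, abs_of_pos hβ, Complex.real_smul] at this
  have hs : (Real.sqrt β * Real.sqrt (1 / β) : ℝ) = 1 := by
    rw [← Real.sqrt_mul hβ.le, mul_one_div_cancel hβ.ne', Real.sqrt_one]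
  have e : ∀ y, starRingEnd ℂ (gaborAtom φ α β p (β⁻¹ * y)) * f (β⁻¹ * y) =
      (Real.sqrt β : ℂ) *
        (starRingEnd ℂ (gaborAtom (dilate φ (1 / β)) (α * β) 1 p y) * f (β⁻¹ * y)) := by
    intro y
    have e1 : gaborAtom φ α β p (β⁻¹ * y) =
        (Real.sqrt β : ℂ) * gaborAtom (dilate φ (1 / β)) (α * β) 1 p y := by
      simp only [gaborAtom, dilate]
      have e2 : (1 / β * (y - α * β * p.1) : ℝ) = β⁻¹ * y - α * p.1 := by field_simp
      have e3 : (2 * Real.pi * Complex.I * β * p.2 * ((β⁻¹ * y : ℝ) : ℂ)) =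
          2 * Real.pi * Complex.I * ((1 : ℝ) : ℂ) * p.2 * y := by
        have : (β : ℂ) ≠ 0 := by exact_mod_cast hβ.ne'
        push_cast
        field_simp
      rw [e2, e3]
      have hs' : (Real.sqrt β : ℂ) * (Real.sqrt (1 / β) : ℂ) = 1 := by exact_mod_cast hs
      linear_combination (-Complex.exp (2 * Real.pi * Complex.I * ((1 : ℝ) : ℂ) * p.2 * y) *
        φ (β⁻¹ * y - α * p.1)) * hs'
    rw [e1, map_mul, Complex.conj_ofReal, mul_assoc]
  simp only [e] at this
  rw [integral_const_mul] at this
  have hβ' : (β : ℂ) ≠ 0 := by exact_mod_cast hβ.ne'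
  push_cast
  rw [mul_assoc, this, inv_mul_cancel_left₀ hβ']

lemma gaborAtom_congr_ae {φ ψ : ℝ → ℂ} (h : φ =ᵐ[volume] ψ) (α β : ℝ) (p : ℤ × ℤ) :
    gaborAtom φ α β p =ᵐ[volume] gaborAtom ψ α β p := by
  have h1 := (measurePreserving_sub_right volume (α * p.1)).quasiMeasurePreserving.ae_eq_comp h
  filter_upwards [h1] with x hx
  simp only [Function.comp_apply] at hx
  simp only [gaborAtom, hx]

lemma memLp_gaborAtom {φ : ℝ → ℂ} (h : MemLp φ 2) (α β : ℝ) (p : ℤ × ℤ) :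
    MemLp (gaborAtom φ α β p) 2 := by
  have h1 := h.comp_measurePreserving (measurePreserving_sub_right volume (α * p.1))
  refine h1.of_le ((Continuous.aestronglyMeasurable (by fun_prop)).mul h1.aestronglyMeasurable)
    (Eventually.of_forall fun x => ?_)
  rw [gaborAtom, norm_mul, show (2 * Real.pi * Complex.I * β * p.2 * x : ℂ) =
    ((2 * Real.pi * β * p.2 * x : ℝ) : ℂ) * Complex.I by push_cast; ring,
    Complex.norm_exp_ofReal_mul_I, one_mul]
  rfl

/-- An integrable function whose Fourier transform has Gaussian decay is square-integrable. -/
lemma GaussianDecay.memLp_two {χ : ℝ → ℂ} (hχ : Integrable χ) {a : ℝ} (ha : 0 < a)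
    (hG : GaussianDecay a fun w => ‖𝓕 χ w‖ ^ 2) : MemLp χ 2 := by
  have hF := (hG.integrable ha hχ.continuous_fourier).1
  refine MemLp.ae_eq (ae_eq_fourierInv_fourier hχ hF).symm ?_
  have hi : Integrable (𝓕⁻ (𝓕 χ)) := hχ.congr (ae_eq_fourierInv_fourier hχ hF)
  rw [memLp_two_iff_integrable_sq_norm hi.aestronglyMeasurable]
  simp only [sq]
  refine hi.norm.bdd_mul (c := ∫ w, ‖𝓕 χ w‖) hi.norm.aestronglyMeasurable
    (Eventually.of_forall fun x => ?_)
  rw [norm_norm]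
  exact VectorFourier.norm_fourierIntegral_le_integral_norm _ _ _ _ _

/-- Frame inequalities on a dense set give a frame. -/
lemma isHilbertFrame_of_dense {ι H : Type*} [NormedAddCommGroup H] [InnerProductSpace ℂ H]
    {e : ι → H} {S : Set H} (hS : Dense S) {A B : ℝ} (hA : 0 < A) (hB : 0 < B)
    (h : ∀ f ∈ S, ENNReal.ofReal A * ENNReal.ofReal (‖f‖ ^ 2) ≤
        ∑' i, ENNReal.ofReal (‖inner ℂ (e i) f‖ ^ 2) ∧
      ∑' i, ENNReal.ofReal (‖inner ℂ (e i) f‖ ^ 2) ≤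
        ENNReal.ofReal B * ENNReal.ofReal (‖f‖ ^ 2)) :
    IsHilbertFrame e := by
  have hfin : ∀ (J : Finset ι) (f : H), ∑ i ∈ J, ‖inner ℂ (e i) f‖ ^ 2 ≤ B * ‖f‖ ^ 2 := by
    intro J f
    have hcl : IsClosed {f : H | ∑ i ∈ J, ‖inner ℂ (e i) f‖ ^ 2 ≤ B * ‖f‖ ^ 2} :=
      isClosed_le (by fun_prop) (by fun_prop)
    refine hcl.closure_subset_iff.2 (fun g hg => ?_) (hS f)
    have h1 := (ENNReal.sum_le_tsum J).trans (h g hg).2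
    rw [← ENNReal.ofReal_sum_of_nonneg fun i _ => by positivity,
      ← ENNReal.ofReal_mul hB.le, ENNReal.ofReal_le_ofReal_iff (by positivity)] at h1
    exact h1
  have hsm : ∀ f : H, Summable fun i => ‖inner ℂ (e i) f‖ ^ 2 := fun f =>
    summable_of_sum_le (fun i => by positivity) fun J => hfin J f
  have hup : ∀ f : H, ∑' i, ‖inner ℂ (e i) f‖ ^ 2 ≤ B * ‖f‖ ^ 2 := fun f =>
    (hsm f).tsum_le_of_sum_le fun J => hfin J f
  refine ⟨A / 2, B, half_pos hA, hB, fun f => ⟨hsm f, ?_, hup f⟩⟩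
  -- Only norms of `g` occur here, so for fixed `f` the condition on `g` is closed without
  -- continuity of the infinite sum. At `g = f` the error vanishes, and the factor `2` accounts for
  -- `A / 2`.
  have key : ∀ g : H, A * ‖g‖ ^ 2 ≤
      2 * (∑' i, ‖inner ℂ (e i) f‖ ^ 2) + 2 * (B * ‖g - f‖ ^ 2) := by
    intro g
    have hcl : IsClosed {g : H | A * ‖g‖ ^ 2 ≤
        2 * (∑' i, ‖inner ℂ (e i) f‖ ^ 2) + 2 * (B * ‖g - f‖ ^ 2)} :=
      isClosed_le (by fun_prop) (by fun_prop)
    refine hcl.closure_subset_iff.2 (fun g hg => ?_) (hS g)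
    have h1 := (h g hg).1
    rw [← ENNReal.ofReal_tsum_of_nonneg (fun i => by positivity) (hsm g),
      ← ENNReal.ofReal_mul hA.le, ENNReal.ofReal_le_ofReal_iff
        (tsum_nonneg fun i => by positivity)] at h1
    have h2 : ∑' i, ‖inner ℂ (e i) g‖ ^ 2 ≤
        ∑' i, (2 * ‖inner ℂ (e i) f‖ ^ 2 + 2 * ‖inner ℂ (e i) (g - f)‖ ^ 2) := by
      refine (hsm g).tsum_le_tsum (fun i => ?_)
        (((hsm f).mul_left 2).add ((hsm (g - f)).mul_left 2))
      have := norm_sq_le_add one_pos (inner ℂ (e i) g) (inner ℂ (e i) f)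
      rw [← inner_sub_right] at this
      norm_num at this
      linarith
    rw [((hsm f).mul_left 2).tsum_add ((hsm (g - f)).mul_left 2), tsum_mul_left,
      tsum_mul_left] at h2
    have h3 := hup (g - f)
    change A * ‖g‖ ^ 2 ≤ _
    linarith
  have := key f
  rw [sub_self, norm_zero] at this
  linarith

lemma dense_continuous_compactSupport :
    Dense {F : Lp ℂ 2 (volume : Measure ℝ) | ∃ f : ℝ → ℂ, Continuous f ∧ HasCompactSupport f ∧
      F =ᵐ[volume] f} := by
  rw [Metric.dense_iff]
  intro F r hr
  obtain ⟨g, hgs, hle, hgc, hgm⟩ := (Lp.memLp F).exists_hasCompactSupport_eLpNorm_sub_le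
    (by norm_num) (ENNReal.ofReal_pos.2 (half_pos hr)).ne'
  refine ⟨hgm.toLp g, ?_, g, hgc, hgs, hgm.coeFn_toLp⟩
  rw [Metric.mem_ball, dist_comm]
  refine lt_of_le_of_lt ?_ (half_lt_self hr)
  rw [Lp.dist_def]
  refine ENNReal.toReal_le_of_le_ofReal (half_pos hr).le (le_trans (le_of_eq ?_) hle)
  exact eLpNorm_congr_ae ((EventuallyEq.refl _ _).sub hgm.coeFn_toLp)

lemma ofReal_norm_sq_Lp {F : Lp ℂ 2 (volume : Measure ℝ)} {f : ℝ → ℂ} (h : F =ᵐ[volume] f) :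
    ENNReal.ofReal (‖F‖ ^ 2) = ∫⁻ x, ENNReal.ofReal (‖f x‖ ^ 2) := by
  have h1 := eLpNorm_nnreal_pow_eq_lintegral (f := F) (μ := (volume : Measure ℝ))
    (p := 2) two_ne_zero
  rw [show ((2 : NNReal) : ℝ≥0∞) = 2 by rfl, ← Lp.enorm_def] at h1
  rw [ENNReal.ofReal_pow (norm_nonneg _), ofReal_norm]
  simp only [NNReal.coe_ofNat, ENNReal.rpow_ofNat] at h1
  rw [h1]
  refine lintegral_congr_ae ?_
  filter_upwards [h] with x hx
  rw [hx, ENNReal.ofReal_pow (norm_nonneg _), ofReal_norm]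

lemma inner_toLp_eq_integral {u : ℝ → ℂ} (hu : MemLp u 2) {F : Lp ℂ 2 (volume : Measure ℝ)}
    {f : ℝ → ℂ} (h : F =ᵐ[volume] f) :
    inner ℂ (hu.toLp u) F = ∫ x, starRingEnd ℂ (u x) * f x := by
  rw [L2.inner_def]
  refine integral_congr_ae ?_
  filter_upwards [h, hu.coeFn_toLp] with x hx hx'
  rw [hx, hx', RCLike.inner_apply, mul_comm]

/-! ### The frame criterion and the theorem. -/

/-- Gabor frame criterion: the dilated window has a Fourier transform with sufficiently strong
Gaussian decay relative to the density of the time shifts. -/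
theorem isGaborFrame_of_gaussianDecay {φ : ℝ → ℂ} {α β a : ℝ} (hα : 0 < α) (hβ : 0 < β)
    (hφ : MemLp φ 2) (hi : Integrable (dilate φ (1 / β))) (ha : 2 * Real.pi ≤ a)
    (hG : GaussianDecay a fun w => ‖𝓕 (dilate φ (1 / β)) w‖ ^ 2)
    (hM : 4 * (α * β) ^ 2 * (1 / 4 + 2 / a * tailConst) < 1) : IsGaborFrame φ α β := by
  set χ := dilate φ (1 / β) with hχ
  have ha0 : 0 < a := by linarith [Real.pi_pos]
  have hFi := (hG.integrable ha0 hi.continuous_fourier).1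
  -- Sampling needs point values, so the window is replaced by its continuous representative; the
  -- inner products do not change.
  set ψ := 𝓕⁻ (𝓕 χ) with hψ
  have hae : χ =ᵐ[volume] ψ := ae_eq_fourierInv_fourier hi hFi
  have hψi : Integrable ψ := hi.congr hae
  have hψc : Continuous ψ := by
    rw [hψ, Real.fourierInv_eq_fourier_comp_neg]
    exact hFi.comp_neg.continuous_fourier
  have hψF : 𝓕 ψ = 𝓕 χ := funext fun w => (Real.fourier_congr_ae hae w).symm
  rw [← hψF] at hG
  obtain ⟨A, B, hA, hB, hs⟩ := exists_sampling_bounds hψc hψi ha hG (mul_pos hα hβ) hM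
  refine ⟨memLp_gaborAtom hφ α β, isHilbertFrame_of_dense dense_continuous_compactSupport hA hB
    ?_⟩
  rintro F ⟨f, hfc, hfs, hFf⟩
  have hβ' : β⁻¹ ≠ 0 := inv_ne_zero hβ.ne'
  have hsup : HasCompactSupport fun y => f (β⁻¹ * y) :=
    hfs.comp_homeomorph (Homeomorph.mulLeft₀ β⁻¹ hβ')
  have key := frame_bounds_of_sampling hψc hs (f := fun y => f (β⁻¹ * y)) (by fun_prop) hsup
  have hN : ∫⁻ y, ENNReal.ofReal (‖f (β⁻¹ * y)‖ ^ 2) =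
      ENNReal.ofReal β * ENNReal.ofReal (‖F‖ ^ 2) := by
    have hfm := hfc.measurable
    rw [ofReal_norm_sq_Lp hFf, ← lintegral_map (f := fun x => ENNReal.ofReal (‖f x‖ ^ 2))
      (by fun_prop) (measurable_const_mul β⁻¹), Real.map_volume_mul_left hβ', inv_inv,
      abs_of_pos hβ, lintegral_smul_measure, smul_eq_mul]
  have hc : ∀ p : ℤ × ℤ, ENNReal.ofReal
      (‖∫ y, starRingEnd ℂ (gaborAtom ψ (α * β) 1 p y) * f (β⁻¹ * y)‖ ^ 2) =
      ENNReal.ofReal β * ENNReal.ofReal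
        (‖inner ℂ ((memLp_gaborAtom hφ α β p).toLp (gaborAtom φ α β p)) F‖ ^ 2) := by
    intro p
    rw [inner_toLp_eq_integral _ hFf, integral_gaborAtom_rescale φ f hβ p, norm_mul, mul_pow,
      Complex.norm_real, Real.norm_eq_abs, sq_abs, mul_pow, Real.sq_sqrt hβ.le,
      ← ENNReal.ofReal_mul hβ.le, ← mul_assoc, show β * (β⁻¹ ^ 2 * β) = 1 by field_simp, one_mul]
    congr 3
    refine integral_congr_ae ?_
    filter_upwards [gaborAtom_congr_ae hae (α * β) 1 p] with y hy
    rw [← hχ, hy]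
  simp only [hc, hN, ENNReal.tsum_mul_left] at key
  rw [mul_left_comm, mul_left_comm (ENNReal.ofReal B)] at key
  have hβ0 : ENNReal.ofReal β ≠ 0 := (ENNReal.ofReal_pos.2 hβ).ne'
  rwa [ENNReal.mul_le_mul_iff_right hβ0 ENNReal.ofReal_ne_top,
    ENNReal.mul_le_mul_iff_right hβ0 ENNReal.ofReal_ne_top] at key

/-- Rescaling `β` to `1` leaves only the ratio of the dilation parameter to `β`, which is why that
ratio can depend on `α * β` alone. -/
lemma dilate_dilate (φ : ℝ → ℂ) {β γ : ℝ} (hβ : 0 < β) :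
    dilate (dilate φ (γ * β)) (1 / β) = dilate φ γ := by
  ext x
  have h1 : Real.sqrt (1 / β) * Real.sqrt (γ * β) = Real.sqrt γ := by
    rw [← Real.sqrt_mul (by positivity)]
    congr 1
    field_simp
  simp only [dilate]
  rw [← mul_assoc, ← Complex.ofReal_mul, h1]
  congr 2
  field_simp

lemma IsTypeI.integrable_dilate {φ : ℝ → ℂ} (h : IsTypeI φ) {γ : ℝ} (hγ : 0 < γ) :
    Integrable (dilate φ γ) :=
  (h.1.comp_mul_left' hγ.ne').const_mul _

theorem theorem4p4 :
    (∀ φ : ℝ → ℂ, IsTypeI φ → ∀ β : ℝ, 0 < β →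
      Tendsto (fun γ : ℝ => constM (dilate φ γ) (1 / β)) (𝓝[>] 0)
        (𝓝 (ENNReal.ofReal (β ^ 2 / 4)))) ∧
    ∃ ρ : ℝ → ℝ, (∀ c : ℝ, 0 < c → c < 1 → 0 < ρ c) ∧
      ∀ φ : ℝ → ℂ, IsTypeI φ → ∀ α β : ℝ, 0 < α → 0 < β → α * β < 1 →
        IsGaborFrame (dilate φ (ρ (α * β) * β)) α β := by
  refine ⟨fun φ h β hβ => tendsto_constM_dilate h hβ,
    -- With `t = ρ²` and `K = tailConst` the rate is `2π/t`, and the criterion asks for `c² +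
    -- 4c²tK/π < 1`. Since `t + 4tK = 1 - c²` and `c²/π < 1`, the summand `t` supplies strictness;
    -- also `t ≤ 1`, so the rate is at least `2π`.
    fun c => Real.sqrt ((1 - c ^ 2) / (1 + 4 * tailConst)), fun c h0 h1 => ?_,
    fun φ h α β hα hβ hαβ => ?_⟩
  · have := tailConst_nonneg
    exact Real.sqrt_pos.2 (div_pos (by nlinarith) (by positivity))
  · have hK := tailConst_nonneg
    have hc0 : 0 < α * β := mul_pos hα hβ
    set c := α * β
    have hc1 : 0 < 1 - c ^ 2 := by nlinarith
    set t := (1 - c ^ 2) / (1 + 4 * tailConst) with ht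
    have ht0 : 0 < t := div_pos hc1 (by positivity)
    have ht1 : t * (1 + 4 * tailConst) = 1 - c ^ 2 := by
      rw [ht]
      field_simp
    have htle : t ≤ 1 := by nlinarith [sq_nonneg c, mul_nonneg ht0.le hK]
    have hρ : 0 < Real.sqrt t := Real.sqrt_pos.2 ht0
    have hγ : 0 < Real.sqrt t * β := mul_pos hρ hβ
    have hd := h.gaussianDecay_dilate hρ
    have hdd := dilate_dilate φ (γ := Real.sqrt t) hβ
    rw [Real.sq_sqrt ht0.le] at hd
    refine isGaborFrame_of_gaussianDecay (a := 2 * Real.pi / t) hα hβ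
      ((h.gaussianDecay_dilate hγ).memLp_two (h.integrable_dilate hγ) (by positivity))
      ?_ ?_ ?_ ?_
    · rw [hdd]
      exact h.integrable_dilate hρ
    · exact le_div_self (by positivity) ht0 htle
    · rw [hdd]
      exact hd
    · have e : 2 / (2 * Real.pi / t) = t / Real.pi := by field_simp
      rw [e]
      have h3 : t / Real.pi * tailConst ≤ t * tailConst := by
        gcongr
        exact div_le_self ht0.le (by linarith [Real.pi_gt_three])
      have h4 : c ^ 2 * (t * tailConst) ≤ t * tailConst :=
        mul_le_of_le_one_left (by positivity) (by linarith)
      change 4 * c ^ 2 * _ < 1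
      nlinarith [mul_le_mul_of_nonneg_left h3 (sq_nonneg c)]
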